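/- For $n\ge 1$ let $(\mathbb F_2^n)^{ev}\subset\mathbb F_2^n$ be the subgroup of vectors with an even number of nonzero coordinates, let the alternating group $A_n$ act on it by permuting coordinates, and let $H=A_n\ltimes(\mathbb F_2^n)^{ev}$. Let $F_n$ be the group of Clifford words, generated by $-1,e_0,\dots,e_{n-1}$ subject to the relations that $-1$ is central with $(-1)^2=1$, that $e_i^2=-1$, and that $e_ie_j=-e_je_i$ for $i\ne j$. Let $F_n^{ev}\subset F_n$ be the subgroup of words with an even number of symbols $e_i$, i.e. the preimage of $(\mathbb F_2^n)^{ev}$ under the homomorphism $F_n\to\mathbb F_2^n$ that sends $e_i$ to the $i$-th basis vector and $-1$ to $0$. Let $\widetilde A_n$ be the spin extension of $A_n$, that is, the preimage of $A_n\subset SO(n)$ (permutation matrices) under $Spin(n)\to SO(n)$; it acts on $F_n^{ev}$ through $A_n$ by permuting the symbols $e_i$. (1) For every $n\ge 5$, the group $H$ is perfect. (2) For every $n\ge 8$, the Schur multiplier $H_2(H;\mathbb Z)$ is a Klein four-group, and the Schur extension (universal central extension) of $H$ is the semidirect product $\widetilde A_n\ltimes F_n^{ev}$: the canonical projection $$\widetilde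 A_n\ltimes F_n^{ev}\longrightarrow A_n\ltimes(\mathbb F_2^n)^{ev}=H$$ is a surjective homomorphism whose kernel is central and is a Klein four-group, and for every central extension $p:K\to H$ there is a unique homomorphism $\varphi:\widetilde A_n\ltimes F_n^{ev}\to K$ such that $p\circ\varphi$ is this projection. -/

import Mathlib

universe w

namespace Hyperoctahedral

/-! ### Even vectors over the field with two elements -/

/-- The coordinate permutation action on `(ZMod 2)^n`, written multiplicatively:
`(σ • v) i = v (σ⁻¹ i)`, so that the basis vector `e_i` is sent to `e_{σ i}`. -/
def permVec (n : ℕ) : Equiv.Perm (Fin n) →* MulAut (Multiplicative (Fin n → ZMod 2)) where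
  toFun σ :=
    { toFun := fun v => Multiplicative.ofAdd fun i => v.toAdd (σ⁻¹ i)
      invFun := fun v => Multiplicative.ofAdd fun i => v.toAdd (σ i)
      left_inv := fun v => by
        apply Multiplicative.toAdd.injective; funext i; simp
      right_inv := fun v => by
        apply Multiplicative.toAdd.injective; funext i; simp
      map_mul' := fun _ _ => rfl }
  map_one' := rfl
  map_mul' _ _ := rfl

/-- The group `(F_2^n)^{ev}` of vectors with an even number of nonzero coordinates, as a subgroup
of `F_2^n` (written multiplicatively). -/
def evenVec (n : ℕ) : Subgroup (Multiplicative (Fin n → ZMod 2)) where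
  carrier := {v | ∑ i, v.toAdd i = 0}
  one_mem' := by simp
  mul_mem' {v w} hv hw := by
    simp only [Set.mem_ofPred_eq, toAdd_mul, Pi.add_apply, Finset.sum_add_distrib] at *
    rw [hv, hw, add_zero]
  inv_mem' {v} hv := by
    simp only [Set.mem_ofPred_eq, toAdd_inv, Pi.neg_apply, Finset.sum_neg_distrib] at *
    rw [hv, neg_zero]

theorem permVec_mem_evenVec {n : ℕ} (σ : Equiv.Perm (Fin n))
    {v : Multiplicative (Fin n → ZMod 2)} (hv : v ∈ evenVec n) : permVec n σ v ∈ evenVec n := by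
  have h : ∑ i, v.toAdd (σ⁻¹ i) = 0 := by
    rw [Equiv.sum_comp (σ⁻¹) (fun i => v.toAdd i)]; exact hv
  exact h

/-- If a group acts by automorphisms preserving a subgroup `S`, it acts on `S`. -/
def restrictAction {G N : Type*} [Group G] [Group N] (φ : G →* MulAut N) (S : Subgroup N)
    (h : ∀ g : G, ∀ x ∈ S, φ g x ∈ S) : G →* MulAut S where
  toFun g :=
    { toFun := fun x => ⟨φ g x, h g x x.2⟩
      invFun := fun x => ⟨φ g⁻¹ x, h g⁻¹ x x.2⟩
      left_inv := fun x => by ext; simp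
      right_inv := fun x => by ext; simp
      map_mul' := fun x y => by ext; simp }
  map_one' := by ext; simp
  map_mul' g g' := by ext; simp

/-- The alternating group acting on `(F_2^n)^{ev}` by permuting coordinates. -/
def altOnEvenVec (n : ℕ) : alternatingGroup (Fin n) →* MulAut (evenVec n) :=
  (restrictAction (permVec n) (evenVec n) fun σ _ hx => permVec_mem_evenVec σ hx).comp
    (alternatingGroup (Fin n)).subtype

/-- The group `A_n ⋉ (F_2^n)^{ev}` of evenly signed even permutations. -/
abbrev EvenSignedPerm (n : ℕ) : Type :=
  evenVec n ⋊[altOnEvenVec n] alternatingGroup (Fin n)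

/-! ### Clifford words -/

/-- The defining relations of the group of Clifford words. The generator `none` stands for the
central element `-1` and `some i` stands for `e_i`. The relations are `(-1)² = 1`,
`(-1) e_i = e_i (-1)`, `e_i² = -1`, and `e_i e_j = (-1) e_j e_i` for `i ≠ j`. -/
inductive CliffordRel (n : ℕ) : FreeGroup (Option (Fin n)) → Prop
  | neg_sq : CliffordRel n (FreeGroup.of none * FreeGroup.of none)
  | neg_central (i : Fin n) : CliffordRel n
      (FreeGroup.of none * FreeGroup.of (some i) *
        (FreeGroup.of (some i) * FreeGroup.of none)⁻¹)
  | sq (i : Fin n) : CliffordRel n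
      (FreeGroup.of (some i) * FreeGroup.of (some i) * (FreeGroup.of none)⁻¹)
  | anticomm (i j : Fin n) (hij : i ≠ j) : CliffordRel n
      (FreeGroup.of (some i) * FreeGroup.of (some j) *
        (FreeGroup.of none * FreeGroup.of (some j) * FreeGroup.of (some i))⁻¹)

/-- The group `F_n` of Clifford words in the symbols `e_i`, `i : Fin n`. -/
abbrev CliffordWord (n : ℕ) : Type :=
  PresentedGroup {r | CliffordRel n r}

namespace CliffordWord

/-- The central element `-1` of `F_n`. -/
def neg (n : ℕ) : CliffordWord n := PresentedGroup.of none

/-- The Clifford symbol `e_i`. -/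
def e {n : ℕ} (i : Fin n) : CliffordWord n := PresentedGroup.of (some i)

theorem mk_eq_one {n : ℕ} {r : FreeGroup (Option (Fin n))} (h : CliffordRel n r) :
    PresentedGroup.mk {r | CliffordRel n r} r = 1 :=
  PresentedGroup.one_of_mem h

theorem neg_sq (n : ℕ) : neg n * neg n = 1 := mk_eq_one .neg_sq

theorem neg_mul_e {n : ℕ} (i : Fin n) : neg n * e i = e i * neg n :=
  mul_inv_eq_one.mp (mk_eq_one (.neg_central i))

theorem e_sq {n : ℕ} (i : Fin n) : e i * e i = neg n :=
  mul_inv_eq_one.mp (mk_eq_one (.sq i))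

theorem e_mul_e {n : ℕ} {i j : Fin n} (hij : i ≠ j) : e i * e j = neg n * e j * e i :=
  mul_inv_eq_one.mp (mk_eq_one (.anticomm i j hij))

/-- The universal property of `F_n`: a homomorphism is given by images of `-1` and the `e_i`
satisfying the relations. -/
def lift {n : ℕ} {G : Type*} [Group G] (z : G) (f : Fin n → G) (h1 : z * z = 1)
    (h2 : ∀ i, z * f i = f i * z) (h3 : ∀ i, f i * f i = z)
    (h4 : ∀ i j, i ≠ j → f i * f j = z * f j * f i) : CliffordWord n →* G :=
  PresentedGroup.toGroup (f := fun o => o.elim z f) <| by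
    rintro r (_ | i | i | ⟨i, j, hij⟩)
    · simpa using h1
    · simpa using mul_inv_eq_one.mpr (h2 i)
    · simpa using mul_inv_eq_one.mpr (h3 i)
    · simpa using mul_inv_eq_one.mpr (h4 i j hij)

@[simp] theorem lift_neg {n : ℕ} {G : Type*} [Group G] (z : G) (f : Fin n → G) (h1 : z * z = 1)
    (h2 : ∀ i, z * f i = f i * z) (h3 : ∀ i, f i * f i = z)
    (h4 : ∀ i j, i ≠ j → f i * f j = z * f j * f i) : lift z f h1 h2 h3 h4 (neg n) = z :=
  PresentedGroup.toGroup.of _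

@[simp] theorem lift_e {n : ℕ} {G : Type*} [Group G] (z : G) (f : Fin n → G) (h1 : z * z = 1)
    (h2 : ∀ i, z * f i = f i * z) (h3 : ∀ i, f i * f i = z)
    (h4 : ∀ i j, i ≠ j → f i * f j = z * f j * f i) (i : Fin n) :
    lift z f h1 h2 h3 h4 (e i) = f i :=
  PresentedGroup.toGroup.of _

theorem hom_ext {n : ℕ} {G : Type*} [Group G] {φ ψ : CliffordWord n →* G}
    (h0 : φ (neg n) = ψ (neg n)) (h : ∀ i, φ (e i) = ψ (e i)) : φ = ψ :=
  PresentedGroup.ext fun o => by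
    cases o with
    | none => exact h0
    | some i => exact h i

/-- The endomorphism of `F_n` fixing `-1` and sending `e_i` to `e_{σ i}`. -/
def permHom {n : ℕ} (σ : Equiv.Perm (Fin n)) : CliffordWord n →* CliffordWord n :=
  lift (neg n) (fun i => e (σ i)) (neg_sq n) (fun _ => neg_mul_e _) (fun _ => e_sq _)
    fun _ _ hij => e_mul_e (σ.injective.ne hij)

@[simp] theorem permHom_neg {n : ℕ} (σ : Equiv.Perm (Fin n)) : permHom σ (neg n) = neg n :=
  lift_neg ..

@[simp] theorem permHom_e {n : ℕ} (σ : Equiv.Perm (Fin n)) (i : Fin n) :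
    permHom σ (e i) = e (σ i) :=
  lift_e ..

theorem permHom_one (n : ℕ) : permHom (1 : Equiv.Perm (Fin n)) = MonoidHom.id _ :=
  hom_ext (by simp) (by simp)

theorem permHom_mul {n : ℕ} (σ τ : Equiv.Perm (Fin n)) :
    permHom (σ * τ) = (permHom σ).comp (permHom τ) :=
  hom_ext (by simp) (by simp)

/-- The symmetric group acting on `F_n` by permuting the Clifford symbols. -/
def perm (n : ℕ) : Equiv.Perm (Fin n) →* MulAut (CliffordWord n) where
  toFun σ := MonoidHom.toMulEquiv (permHom σ) (permHom σ⁻¹)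
    (by rw [← permHom_mul, inv_mul_cancel, permHom_one])
    (by rw [← permHom_mul, mul_inv_cancel, permHom_one])
  map_one' := MulEquiv.ext fun w => DFunLike.congr_fun (permHom_one n) w
  map_mul' σ τ := MulEquiv.ext fun w => DFunLike.congr_fun (permHom_mul σ τ) w

/-- The homomorphism `F_n → F_2^n` with kernel `{±1}`, sending `e_i` to the `i`-th basis
vector. -/
def toVec (n : ℕ) : CliffordWord n →* Multiplicative (Fin n → ZMod 2) :=
  lift 1 (fun i => Multiplicative.ofAdd (Pi.single i 1)) (one_mul 1) (by simp)
    (fun i => by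
      rw [← ofAdd_add, ← Pi.single_add, show (1 : ZMod 2) + 1 = 0 from rfl, Pi.single_zero,
        ofAdd_zero])
    (fun i j _ => by rw [one_mul, mul_comm])

@[simp] theorem toVec_neg (n : ℕ) : toVec n (neg n) = 1 := lift_neg ..

@[simp] theorem toVec_e {n : ℕ} (i : Fin n) :
    toVec n (e i) = Multiplicative.ofAdd (Pi.single i 1) := lift_e ..

theorem toVec_perm {n : ℕ} (σ : Equiv.Perm (Fin n)) (w : CliffordWord n) :
    toVec n (perm n σ w) = permVec n σ (toVec n w) := by
  have h : (toVec n).comp (permHom σ) = (permVec n σ).toMonoidHom.comp (toVec n) := by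
    refine hom_ext (by simp) fun i => ?_
    apply Multiplicative.toAdd.injective
    funext j
    simp [permVec, Pi.single_apply, Equiv.symm_apply_eq]
  exact DFunLike.congr_fun h w

end CliffordWord

/-- The group `F_n^{ev}` of even Clifford words, the words with an even number of symbols `e_i`:
the preimage of `(F_2^n)^{ev}` in `F_n`. -/
def evenWord (n : ℕ) : Subgroup (CliffordWord n) := (evenVec n).comap (CliffordWord.toVec n)

/-- The projection `F_n^{ev} → (F_2^n)^{ev}`. -/
def evenWordToVec (n : ℕ) : evenWord n →* evenVec n :=
  ((CliffordWord.toVec n).comp (evenWord n).subtype).codRestrict (evenVec n) fun w => w.2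

/-- The alternating group acting on `F_n^{ev}` by permuting the Clifford symbols. -/
def altOnEvenWord (n : ℕ) : alternatingGroup (Fin n) →* MulAut (evenWord n) :=
  (restrictAction (CliffordWord.perm n) (evenWord n) fun σ w hw => by
    have h := permVec_mem_evenVec σ (show CliffordWord.toVec n w ∈ evenVec n from hw)
    rw [← CliffordWord.toVec_perm] at h
    exact h).comp (alternatingGroup (Fin n)).subtype

/-! ### The spin extension of the alternating group -/

/-- The quadratic form `v ↦ -(v_0² + ⋯ + v_{n-1}²)` on `ℝ^n`; in its Clifford algebra the standard
basis vectors satisfy `e_i² = -1` and `e_i e_j = - e_j e_i`. -/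
noncomputable def cliffordForm (n : ℕ) : QuadraticForm ℝ (Fin n → ℝ) :=
  QuadraticMap.weightedSumSquares ℝ fun _ : Fin n => (-1 : ℝ)

/-- The standard basis vector `e_i` in the Clifford algebra `Cl_n`. -/
noncomputable def cliffordBasis {n : ℕ} (i : Fin n) : CliffordAlgebra (cliffordForm n) :=
  CliffordAlgebra.ι (cliffordForm n) (Pi.single i 1)

/-- The spin extension `Ã_n`, the preimage of `A_n ⊆ SO(n)` under `Spin(n) → SO(n)`, realised as the
fibre product of `Spin(n)` and `A_n` over `SO(n)`: it consists of the pairs `(x, σ)` of a spin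
element and an even permutation with `x e_i x⁻¹ = e_{σ i}` for all `i`. -/
def SpinAlternating (n : ℕ) : Subgroup (spinGroup (cliffordForm n) × alternatingGroup (Fin n)) where
  carrier := {p | ∀ i : Fin n,
    (p.1 : CliffordAlgebra (cliffordForm n)) * cliffordBasis i =
      cliffordBasis ((p.2 : Equiv.Perm (Fin n)) i) * (p.1 : CliffordAlgebra (cliffordForm n))}
  one_mem' := by intro i; simp
  mul_mem' {p q} hp hq := by
    intro i
    have h1 := hq i
    have h2 := hp ((q.2 : Equiv.Perm (Fin n)) i)
    simp only [Prod.fst_mul, Prod.snd_mul, Subgroup.coe_mul, Submonoid.coe_mul,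
      Equiv.Perm.mul_apply]
    rw [mul_assoc, h1, ← mul_assoc, h2, mul_assoc]
  inv_mem' {p} hp := by
    intro i
    have h := hp ((p.2 : Equiv.Perm (Fin n))⁻¹ i)
    rw [show (p.2 : Equiv.Perm (Fin n)) ((p.2 : Equiv.Perm (Fin n))⁻¹ i) = i from
      Equiv.apply_symm_apply _ _] at h
    have ha : ((p.1⁻¹ : spinGroup (cliffordForm n)) : CliffordAlgebra (cliffordForm n)) *
        (p.1 : CliffordAlgebra (cliffordForm n)) = 1 := by
      rw [← Submonoid.coe_mul, inv_mul_cancel, Submonoid.coe_one]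
    have hb : (p.1 : CliffordAlgebra (cliffordForm n)) *
        ((p.1⁻¹ : spinGroup (cliffordForm n)) : CliffordAlgebra (cliffordForm n)) = 1 := by
      rw [← Submonoid.coe_mul, mul_inv_cancel, Submonoid.coe_one]
    simp only [Prod.fst_inv, Prod.snd_inv, Subgroup.coe_inv]
    calc _ = ((p.1⁻¹ : spinGroup (cliffordForm n)) : CliffordAlgebra (cliffordForm n)) *
          (cliffordBasis i * (p.1 : CliffordAlgebra (cliffordForm n))) *
          ((p.1⁻¹ : spinGroup (cliffordForm n)) : CliffordAlgebra (cliffordForm n)) := by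
            rw [mul_assoc, mul_assoc, hb, mul_one]
      _ = _ := by rw [← h, ← mul_assoc, ha, one_mul]

/-- The projection `Ã_n → A_n`. -/
noncomputable def spinToAlt (n : ℕ) : SpinAlternating n →* alternatingGroup (Fin n) :=
  (MonoidHom.snd _ _).comp (SpinAlternating n).subtype

/-! ### The semidirect product `Ã_n ⋉ F_n^{ev}` -/

/-- The semidirect product `Ã_n ⋉ F_n^{ev}`, where `Ã_n` acts through `A_n` by permuting the
Clifford symbols. -/
abbrev SpinEvenSignedPerm (n : ℕ) : Type :=
  evenWord n ⋊[(altOnEvenWord n).comp (spinToAlt n)] SpinAlternating n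

/-- The projection `Ã_n ⋉ F_n^{ev} → A_n ⋉ (F_2^n)^{ev}`. -/
noncomputable def spinProj (n : ℕ) : SpinEvenSignedPerm n →* EvenSignedPerm n :=
  SemidirectProduct.map (evenWordToVec n) (spinToAlt n) fun g => by
    ext w : 2
    exact CliffordWord.toVec_perm _ _

end Hyperoctahedral

/-! ### Schur multipliers and Schur extensions -/

/-- The Schur multiplier `H_2(G; ℤ)` of a group. -/
noncomputable abbrev SchurMultiplier (G : Type) [Group G] : Type :=
  groupHomology (Rep.trivial ℤ G ℤ) 2

/-- `π : G → H` is a central extension of `H`. -/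
structure IsCentralExtension {G H : Type*} [Group G] [Group H] (π : G →* H) : Prop where
  surjective : Function.Surjective π
  ker_le_center : π.ker ≤ Subgroup.center G

/-- `π : G → H` is a universal central extension (Schur extension) of `H`: it is central, and it
maps uniquely, over `H`, to every central extension of `H`. -/
structure IsUniversalCentralExtension.{k, u, v} {G : Type u} {H : Type v} [Group G] [Group H]
    (π : G →* H) : Prop extends IsCentralExtension π where
  existsUnique_lift : ∀ (K : Type k) [Group K] (p : K →* H), IsCentralExtension p →
    ∃! φ : G →* K, p.comp φ = π

/-! Perfectness of $H$: $A_n$ is perfect, and in the abelianization all the vectors $e_i+e_j$ have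
one common image $x$. Since $(e_i+e_j)+(e_j+e_k)=e_i+e_k$, this gives $x^2=x$, so $x=1$.

Universality rests on canonical lifts. Let $p:K\to H$ be a central extension and let $f(s)\in H$ be
an equivariant family indexed by injective $k$-tuples. The stabilizer of $s$ in $A_n$ is the
alternating group on the other $n-k$ points, perfect when $n-k\ge 5$. Commutators of its lifts with
a lift of $f(s)$ form a homomorphism to an abelian group, so they vanish. Hence conjugation spreads
one chosen lift to an equivariant family in $K$ (`IsCentralExtension.exists_equivariant_lift`). By
multiple transitivity each relation among the $f(s)$ holds among the lifts up to one central
constant, and rescaling normalizes the constants.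

For the pairs $e_i+e_j$ ($k=2$) the normalized relations are those of the words $e_ie_j$. As
$e_i\mapsto e_ie_{n-1}$ identifies $F_{n-1}$ with $F_n^{ev}$, they give an equivariant map
$F_n^{ev}\to K$ (`exists_evenWord_lift`). For three-cycles ($k=3$, hence $n\ge 8$) they become
Carmichael's relations $t_i^3=1$, $(t_it_j)^2=z$ with $z$ central and $z^2=1$. Coset enumeration
bounds the generated group by $n!=|\widetilde A_n|$. Inside the fibre product with $\widetilde A_n$
this group maps onto $\widetilde A_n$, so it is the graph of a lift
(`IsCentralExtension.exists_lift_of_double_cover`). The two lifts glue to the semidirect product.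

Both elements $-1$ of the kernel are commutators, so $\widetilde A_n\ltimes F_n^{ev}$ is perfect and
lifts are unique. Both are nontrivial, as the real Clifford algebra shows, so the kernel is a Klein
four-group. Finally, comparison with the extension by $C_2/B_2$ given by the tautological cocycle
identifies $H_2(H;\mathbb Z)$ with this kernel (`IsUniversalCentralExtension.exists_chain_hom`). -/

/-! ### Perfect groups -/

/-- A homomorphism from a perfect group to a commutative group is trivial. -/
theorem Group.IsPerfect.hom_eq_one {G A : Type*} [Group G] [CommGroup A] (h : Group.IsPerfect G)
    (f : G →* A) (g : G) : f g = 1 := by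
  have hg : g ∈ commutator G := by rw [h.commutator_eq_top]; trivial
  exact Abelianization.commutator_subset_ker f hg

open scoped IsMulCommutative in
/-- Two homomorphisms from a perfect group that agree modulo the center are equal. -/
theorem Group.IsPerfect.hom_ext {G K H : Type*} [Group G] [Group K] [Group H]
    (h : Group.IsPerfect G) {p : K →* H} (hp : p.ker ≤ Subgroup.center K) {φ ψ : G →* K}
    (hφ : p.comp φ = p.comp ψ) : φ = ψ := by
  have hc : ∀ g, φ g * (ψ g)⁻¹ ∈ Subgroup.center K := fun g => hp <| by
    have := DFunLike.congr_fun hφ g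
    simp only [MonoidHom.comp_apply] at this
    simp [MonoidHom.mem_ker, this]
  -- The quotient of two lifts takes central values, which is exactly what makes it multiplicative.
  let δ : G →* Subgroup.center K :=
    { toFun := fun g => ⟨φ g * (ψ g)⁻¹, hc g⟩
      map_one' := by ext; simp
      map_mul' := fun a b => by
        ext
        have := Subgroup.mem_center_iff.mp (hc b) (ψ a)⁻¹
        simp only [map_mul, mul_inv_rev, Subgroup.coe_mul]
        calc φ a * φ b * ((ψ b)⁻¹ * (ψ a)⁻¹) = φ a * (φ b * (ψ b)⁻¹ * (ψ a)⁻¹) := by group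
          _ = _ := by rw [← this]; group }
  ext g
  have := congrArg Subtype.val (h.hom_eq_one δ g)
  exact mul_inv_eq_one.mp this

/-! ### The extension of a group defined by a cocycle with trivial action -/

/-- The underlying set of the extension of `H` by `M` defined by a 2-cocycle `u`. -/
@[ext]
structure CocycleExtension {H M : Type*} (u : H → H → M) where
  /-- the component in the kernel -/
  fst : M
  /-- the component in the quotient -/
  snd : H

namespace CocycleExtension

variable {H M : Type*} [Group H] [AddCommGroup M] {u : H → H → M}

/-- The group structure defined by a 2-cocycle. -/
@[reducible]
def group (hu : ∀ g h j, u h j + u g (h * j) = u (g * h) j + u g h) :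
    Group (CocycleExtension u) where
  mul x y := ⟨x.fst + y.fst + u x.snd y.snd, x.snd * y.snd⟩
  -- The cocycle is not assumed normalized; the cocycle identity only gives $u(1,h)=u(1,1)=u(h,1)$,
  -- whence this correction.
  one := ⟨-u 1 1, 1⟩
  inv x := ⟨-x.fst - u x.snd⁻¹ x.snd - u 1 1, x.snd⁻¹⟩
  mul_assoc x y z := by
    refine CocycleExtension.ext ?_ (mul_assoc _ _ _)
    change x.fst + y.fst + u x.snd y.snd + z.fst + u (x.snd * y.snd) z.snd =
      x.fst + (y.fst + z.fst + u y.snd z.snd) + u x.snd (y.snd * z.snd)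
    have := hu x.snd y.snd z.snd
    rw [show x.fst + (y.fst + z.fst + u y.snd z.snd) + u x.snd (y.snd * z.snd) =
      x.fst + y.fst + z.fst + (u y.snd z.snd + u x.snd (y.snd * z.snd)) by abel, this]
    abel
  one_mul x := by
    refine CocycleExtension.ext ?_ (one_mul _)
    change -u 1 1 + x.fst + u 1 x.snd = x.fst
    have := hu 1 1 x.snd
    simp only [one_mul, add_right_inj] at this
    rw [this]; abel
  mul_one x := by
    refine CocycleExtension.ext ?_ (mul_one _)
    change x.fst + -u 1 1 + u x.snd 1 = x.fst
    have := hu x.snd 1 1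
    simp only [mul_one] at this
    rw [add_comm, add_right_inj] at this
    rw [← this]; abel
  inv_mul_cancel x := by
    refine CocycleExtension.ext ?_ (inv_mul_cancel _)
    change -x.fst - u x.snd⁻¹ x.snd - u 1 1 + x.fst + u x.snd⁻¹ x.snd = -u 1 1
    abel

end CocycleExtension

/-! ### The second homology of a group with a universal central extension -/

/-- The 2-boundaries of a group with integral coefficients. -/
noncomputable def intBoundaries₂ (H : Type*) [Group H] : AddSubgroup (H × H →₀ ℤ) :=
  AddSubgroup.closure (Set.range fun t : H × H × H =>
    Finsupp.single (t.2.1, t.2.2) (1 : ℤ) - Finsupp.single (t.1 * t.2.1, t.2.2) 1 +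
      Finsupp.single (t.1, t.2.1 * t.2.2) 1 - Finsupp.single (t.1, t.2.1) 1)

/-- The differential from 2-chains to 1-chains with integral coefficients. -/
noncomputable def intDiff₂ (H : Type*) [Group H] : (H × H →₀ ℤ) →+ (H →₀ ℤ) :=
  Finsupp.liftAddHom fun t => (zmultiplesHom _
    (Finsupp.single t.2 (1 : ℤ) - Finsupp.single (t.1 * t.2) 1 + Finsupp.single t.1 1))

theorem intDiff₂_single {H : Type*} [Group H] (t : H × H) :
    intDiff₂ H (Finsupp.single t 1) =
      Finsupp.single t.2 (1 : ℤ) - Finsupp.single (t.1 * t.2) 1 + Finsupp.single t.1 1 := by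
  simp [intDiff₂]

theorem intBoundaries₂_le_ker (H : Type*) [Group H] : intBoundaries₂ H ≤ (intDiff₂ H).ker := by
  rw [intBoundaries₂, AddSubgroup.closure_le]
  rintro _ ⟨⟨a, b, c⟩, rfl⟩
  simp only [SetLike.mem_coe, AddMonoidHom.mem_ker, map_sub, map_add, intDiff₂_single, mul_assoc]
  abel

theorem finsupp_int_addHom_ext {α A : Type*} [AddCommGroup A] {f g : (α →₀ ℤ) →+ A}
    (h : ∀ a, f (Finsupp.single a 1) = g (Finsupp.single a 1)) : f = g := by
  refine Finsupp.addHom_ext fun a n => ?_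
  rw [← mul_one n, ← smul_eq_mul, ← Finsupp.smul_single, map_zsmul, map_zsmul, h]

open scoped IsMulCommutative in
/-- For a universal central extension `π` of `H` by a perfect group, a set-theoretic section
defines a homomorphism from 2-chains of `H` that identifies 2-cycles modulo 2-boundaries with
the kernel of `π`. -/
theorem IsUniversalCentralExtension.exists_chain_hom {E H : Type} [Group E] [Group H] {π : E →* H}
    (hπ : IsUniversalCentralExtension.{0} π) (hE : Group.IsPerfect E) :
    ∃ f : (H × H →₀ ℤ) →+ Additive (Subgroup.center E),
      (∀ x, π (f x).toMul.1 = 1) ∧ (∀ x, intDiff₂ H x = 0 → (f x = 0 ↔ x ∈ intBoundaries₂ H)) ∧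
      ∀ k ∈ π.ker, ∃ x, intDiff₂ H x = 0 ∧ ((f x).toMul : E) = k := by
  choose s hs using hπ.surjective
  have hc : ∀ t : H × H, s t.1 * s t.2 * (s (t.1 * t.2))⁻¹ ∈ Subgroup.center E := fun t =>
    hπ.ker_le_center (by simp [MonoidHom.mem_ker, hs])
  -- This is the factor set of the section `s`, extended additively to chains.
  let f : (H × H →₀ ℤ) →+ Additive (Subgroup.center E) :=
    Finsupp.liftAddHom fun t => zmultiplesHom _ (Additive.ofMul ⟨_, hc t⟩)
  have hf1 : ∀ t : H × H, ((f (Finsupp.single t 1)).toMul : E) = s t.1 * s t.2 * (s (t.1 * t.2))⁻¹ :=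
    fun t => by simp [f]
  have hfs : ∀ g h : H, ((f (Finsupp.single (g, h) 1)).toMul : E) * s (g * h) = s g * s h :=
    fun g h => by rw [hf1]; simp
  have hcen : ∀ (z : Additive (Subgroup.center E)) (x : E), x * (z.toMul : E) = z.toMul * x :=
    fun z x => Subgroup.mem_center_iff.mp z.toMul.2 x
  have hfπ : ∀ x, π (f x).toMul.1 = 1 := by
    have : (MonoidHom.toAdditive (π.comp (Subgroup.center E).subtype)).comp f = 0 := by
      refine Finsupp.addHom_ext fun a n => ?_
      rw [← mul_one n, ← smul_eq_mul, ← Finsupp.smul_single, map_zsmul, map_zsmul]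
      have : (MonoidHom.toAdditive (π.comp (Subgroup.center E).subtype)).comp f
        (Finsupp.single a 1) = 0 := by
          change Additive.ofMul (π (f (Finsupp.single a 1)).toMul.1) = 0
          rw [hf1]; simp [hs]
      rw [this]; simp
    exact fun x => DFunLike.congr_fun this x
  have hfB : intBoundaries₂ H ≤ f.ker := by
    rw [intBoundaries₂, AddSubgroup.closure_le]
    rintro _ ⟨⟨a, b, c⟩, rfl⟩
    simp only [SetLike.mem_coe, AddMonoidHom.mem_ker, map_sub, map_add]
    rw [sub_eq_zero, sub_add_eq_add_sub, sub_eq_iff_eq_add]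
    apply Additive.toMul.injective
    apply Subtype.ext
    simp only [toMul_add, Subgroup.coe_mul]
    refine mul_right_cancel (b := s (a * (b * c))) ?_
    rw [mul_assoc, hfs, ← mul_assoc, ← hcen, mul_assoc, hfs, mul_assoc _ _ (s (a * (b * c))),
      ← mul_assoc a, hfs, ← mul_assoc _ (s (a * b)), hfs, mul_assoc]
  -- The tautological cocycle: the boundary relations are precisely the cocycle identity. Every
  -- factor set on $H$ with trivial action is a specialization of it.
  let u : H → H → (H × H →₀ ℤ) ⧸ intBoundaries₂ H := fun g h =>
    QuotientAddGroup.mk (Finsupp.single (g, h) 1)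
  have hu : ∀ g h j, u h j + u g (h * j) = u (g * h) j + u g h := by
    intro g h j
    rw [← sub_eq_zero]
    refine (QuotientAddGroup.eq_zero_iff (N := intBoundaries₂ H)
      (Finsupp.single (h, j) 1 + Finsupp.single (g, h * j) 1 -
        (Finsupp.single (g * h, j) 1 + Finsupp.single (g, h) 1))).mpr ?_
    have h1 : _ ∈ intBoundaries₂ H := AddSubgroup.subset_closure ⟨(g, h, j), rfl⟩
    simp only at h1
    rwa [sub_add_eq_add_sub, sub_sub] at h1
  let := CocycleExtension.group hu
  let fM : (H × H →₀ ℤ) ⧸ intBoundaries₂ H →+ Additive (Subgroup.center E) :=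
    QuotientAddGroup.lift _ f hfB
  let F : CocycleExtension u →* E := MonoidHom.mk' (fun x => (fM x.fst).toMul * s x.snd) <| by
    intro x y
    change ((fM (x.fst + y.fst + u x.snd y.snd)).toMul : E) * s (x.snd * y.snd) = _
    rw [map_add fM, map_add fM, toMul_add, toMul_add, Subgroup.coe_mul, Subgroup.coe_mul, mul_assoc,
      show fM (u x.snd y.snd) = f (Finsupp.single (x.snd, y.snd) 1) from rfl, hfs]
    simp only [mul_assoc]
    rw [← mul_assoc (s x.snd), hcen, mul_assoc]
  let pr : CocycleExtension u →* H := MonoidHom.mk' (fun x => x.snd) fun _ _ => rfl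
  have hpr : IsCentralExtension pr := by
    refine ⟨fun h => ⟨⟨0, h⟩, rfl⟩, fun x hx => Subgroup.mem_center_iff.mpr fun y => ?_⟩
    have hx : x.snd = 1 := hx
    refine CocycleExtension.ext ?_ ?_
    · change y.fst + x.fst + u y.snd x.snd = x.fst + y.fst + u x.snd y.snd
      have h1 := hu 1 1 y.snd
      have h2 := hu y.snd 1 1
      simp only [one_mul, mul_one, add_right_inj] at h1 h2
      rw [add_comm, add_right_inj] at h2
      rw [hx, h1, ← h2]; abel
    · change y.snd * x.snd = x.snd * y.snd
      rw [hx, one_mul, mul_one]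
  obtain ⟨φ, hφ, -⟩ := hπ.existsUnique_lift _ pr hpr
  have hφ' : ∀ e, (φ e).snd = π e := fun e => DFunLike.congr_fun hφ e
  have hπF : ∀ x, π (F x) = x.snd := by
    intro x
    obtain ⟨m, hm⟩ := QuotientAddGroup.mk_surjective x.fst
    change π (((fM x.fst).toMul : E) * s x.snd) = _
    rw [← hm, map_mul, hs]
    exact mul_eq_right.mpr (hfπ m)
  -- Both sides are endomorphisms of $E$ over $H$, and $E$ is perfect.
  have hFφ : F.comp φ = MonoidHom.id E := by
    refine hE.hom_ext hπ.ker_le_center ?_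
    ext e
    simp [hπF, hφ']
  let dM : (H × H →₀ ℤ) ⧸ intBoundaries₂ H →+ (H →₀ ℤ) :=
    QuotientAddGroup.lift _ (intDiff₂ H) (intBoundaries₂_le_ker H)
  have hdu : ∀ g h, dM (u g h) = Finsupp.single h (1 : ℤ) - Finsupp.single (g * h) 1 +
      Finsupp.single g 1 := fun g h => intDiff₂_single (g, h)
  -- The formula $(m,h)\mapsto dm+[h]$ is multiplicative because $du(g,h)=[h]-[gh]+[g]$. Its target
  -- is abelian, so it vanishes on the image of the perfect group $E$; this later forces the chains
  -- found in $\varphi(\ker\pi)$ to be cycles.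
  let ℓ : CocycleExtension u →* Multiplicative (H →₀ ℤ) :=
    MonoidHom.mk' (fun x => Multiplicative.ofAdd (dM x.fst + Finsupp.single x.snd 1)) <| by
      intro x y
      change Multiplicative.ofAdd (dM (x.fst + y.fst + u x.snd y.snd) +
        Finsupp.single (x.snd * y.snd) 1) = _
      rw [map_add dM, map_add dM, hdu, ← ofAdd_add]
      congr 1
      abel
  have hs1 : ((fM (u 1 1)).toMul : E) = s 1 := by
    have := hf1 (1, 1)
    simpa using! this
  let ι : Multiplicative ((H × H →₀ ℤ) ⧸ intBoundaries₂ H) →* CocycleExtension u :=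
    MonoidHom.mk' (fun m => ⟨m.toAdd - u 1 1, 1⟩) fun a b => by
      refine CocycleExtension.ext ?_ (one_mul 1).symm
      change a.toAdd + b.toAdd - u 1 1 = a.toAdd - u 1 1 + (b.toAdd - u 1 1) + u 1 1
      abel
  have hFι : ∀ m, F (ι m) = ((fM m.toAdd).toMul : E) := by
    intro m
    change ((fM (m.toAdd - u 1 1)).toMul : E) * s 1 = _
    rw [← hs1, ← Subgroup.coe_mul, ← toMul_add, ← map_add, sub_add_cancel]
  refine ⟨f, hfπ, fun x hx => ⟨fun hfx => ?_, fun hx => hfB hx⟩, fun k hk => ?_⟩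
  -- The endomorphism $\theta$ lies over $H$, so $k^{-1}\theta(k)$ defines a homomorphism $D$ to
  -- $C_2/B_2$. Its restriction to chains factors through $d$, so $\theta$ fixes the classes of
  -- cycles. If moreover $f(x)=0$, then $\theta$ kills the class of $x$, so that class is zero.
  · let θ : CocycleExtension u →* CocycleExtension u := φ.comp F
    have hδ : ∀ k, (k⁻¹ * θ k).snd = 1 := fun k => by
      change k.snd⁻¹ * (φ (F k)).snd = 1
      rw [hφ', hπF, inv_mul_cancel]
    have hι : ∀ k : CocycleExtension u, k.snd = 1 →
        ι (Multiplicative.ofAdd (k.fst + u 1 1)) = k := fun k hk =>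
      CocycleExtension.ext (add_sub_cancel_right _ _) hk.symm
    have hιinj : Function.Injective ι := fun a b hab => by
      have := congrArg CocycleExtension.fst hab
      exact Multiplicative.toAdd.injective (sub_left_injective this)
    have hιc : ∀ m, ι m ∈ Subgroup.center (CocycleExtension u) := fun m => hpr.ker_le_center rfl
    choose D hD using fun k => (⟨_, hι _ (hδ k)⟩ : ∃ m, ι m = k⁻¹ * θ k)
    let D' : CocycleExtension u →* Multiplicative ((H × H →₀ ℤ) ⧸ intBoundaries₂ H) :=
      MonoidHom.mk' D fun a b => hιinj <| by
        rw [map_mul, hD, ← mul_inv_cancel_right (ι (D a)) (b⁻¹), inv_inv,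
          ← Subgroup.mem_center_iff.mp (hιc (D a)) b⁻¹, hD, hD, map_mul]
        group
    let α : (H × H →₀ ℤ) →+ (H × H →₀ ℤ) ⧸ intBoundaries₂ H :=
      (MonoidHom.toAdditiveLeft (D'.comp ι)).comp (QuotientAddGroup.mk' _)
    let β : (H →₀ ℤ) →+ (H × H →₀ ℤ) ⧸ intBoundaries₂ H :=
      Finsupp.liftAddHom fun h => zmultiplesHom _ (D' ⟨0, h⟩).toAdd
    -- In the extension $u(g,h)$ equals $(0,g)(0,h)(0,gh)^{-1}$, and $D$ turns this into the formula
    -- for $d$.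
    have hαβ : α = β.comp (intDiff₂ H) := by
      refine finsupp_int_addHom_ext fun t => ?_
      obtain ⟨g, h⟩ := t
      rw [AddMonoidHom.comp_apply, intDiff₂_single, map_add, map_sub]
      simp only [β, Finsupp.liftAddHom_apply_single, zmultiplesHom_apply, one_zsmul]
      rw [sub_add_eq_add_sub, eq_sub_iff_add_eq, add_comm _ (D' ⟨0, g⟩).toAdd, ← toAdd_mul,
        ← map_mul]
      change (D' (ι (Multiplicative.ofAdd (u g h)))).toAdd + _ = _
      rw [← toAdd_mul, ← map_mul]
      congr 2
      refine CocycleExtension.ext ?_ (one_mul _)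
      change u g h - u 1 1 + 0 + u 1 (g * h) = 0 + 0 + u g h
      have h1 := hu 1 1 (g * h)
      simp only [one_mul, add_right_inj] at h1
      rw [h1]; abel
    have h0 : α x = 0 := by rw [hαβ, AddMonoidHom.comp_apply, hx, map_zero]
    have h1 := hD (ι (Multiplicative.ofAdd (QuotientAddGroup.mk x)))
    rw [show D (ι (Multiplicative.ofAdd (QuotientAddGroup.mk x))) = 1 from h0, map_one] at h1
    have h2 : θ (ι (Multiplicative.ofAdd (QuotientAddGroup.mk x))) = 1 := by
      change φ (F _) = 1
      rw [hFι]
      change φ ((f x).toMul : E) = 1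
      rw [hfx]; simp
    rw [h2, mul_one, eq_comm, inv_eq_one] at h1
    exact (QuotientAddGroup.eq_zero_iff x).mp (hιinj (h1.trans (map_one ι).symm))
  · have hk : π k = 1 := hk
    have hsnd : (φ k).snd = 1 := (hφ' k).trans hk
    have h1 : dM (φ k).fst + Finsupp.single (φ k).snd 1 = 0 := hE.hom_eq_one (ℓ.comp φ) k
    obtain ⟨x, hx⟩ := QuotientAddGroup.mk_surjective ((φ k).fst + u 1 1)
    have h2 : intDiff₂ H x = 0 := by
      change dM (QuotientAddGroup.mk x) = 0
      rw [hx, map_add, hdu, mul_one, sub_self, zero_add, ← h1, hsnd]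
    refine ⟨x, h2, ?_⟩
    have h3 : F (φ k) = k := DFunLike.congr_fun hFφ k
    have h4 : ι (Multiplicative.ofAdd (QuotientAddGroup.mk x)) = φ k := by
      rw [hx]
      exact CocycleExtension.ext (add_sub_cancel_right _ _) hsnd.symm
    rw [← h4, hFι] at h3
    exact h3

/-- The Schur multiplier of a group is the kernel of any universal central extension of it by a
perfect group. -/
theorem IsUniversalCentralExtension.nonempty_schurMultiplier_equiv {E H : Type} [Group E] [Group H]
    {π : E →* H} (hπ : IsUniversalCentralExtension.{0} π) (hE : Group.IsPerfect E) :
    Nonempty (Multiplicative (SchurMultiplier H) ≃* π.ker) := by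
  obtain ⟨f, hfπ, hf0, hfs⟩ := hπ.exists_chain_hom hE
  let A : Rep ℤ H := Rep.trivial ℤ H ℤ
  let j : groupHomology.cycles₂ A →+ (H × H →₀ ℤ) :=
    (groupHomology.cycles₂ A).subtype.toAddMonoidHom
  have hj : ∀ x, intDiff₂ H x = 0 ↔ x ∈ groupHomology.cycles₂ A := by
    intro x
    have : (groupHomology.d₂₁ A).hom.toAddMonoidHom = intDiff₂ H :=
      finsupp_int_addHom_ext fun t => by
        rw [intDiff₂_single]
        exact groupHomology.d₂₁_single t _
    rw [← this]; rfl
  have hB : ∀ x, x ∈ groupHomology.boundaries₂ A ↔ x ∈ intBoundaries₂ H := by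
    intro x
    have h1 : (groupHomology.boundaries₂ A).toAddSubgroup =
        (groupHomology.d₃₂ A).hom.toAddMonoidHom.range := by
      ext; rfl
    have h2 : (groupHomology.boundaries₂ A).toAddSubgroup = intBoundaries₂ H := by
      rw [h1]
      apply le_antisymm
      · rw [AddMonoidHom.range_eq_map, AddSubgroup.map_le_iff_le_comap, intBoundaries₂]
        intro y _
        induction y using Finsupp.induction_linear with
        | zero => exact zero_mem _
        | add a b ha hb => exact add_mem (ha trivial) (hb trivial)
        | single t n =>
          have h3 : (groupHomology.d₃₂ A).hom (Finsupp.single t (1 : ℤ)) ∈ intBoundaries₂ H :=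
            AddSubgroup.subset_closure ⟨t, (groupHomology.d₃₂_single (A := A) t (1 : ℤ)).symm⟩
          have h4 : (Finsupp.single t n : H × H × H →₀ ℤ) = n • Finsupp.single t (1 : ℤ) := by
            rw [Finsupp.smul_single, smul_eq_mul, mul_one]
          change (groupHomology.d₃₂ A).hom (Finsupp.single t n : H × H × H →₀ ℤ) ∈ intBoundaries₂ H
          rw [h4, map_zsmul]
          exact zsmul_mem h3 n
      · rw [intBoundaries₂, AddSubgroup.closure_le]
        rintro _ ⟨t, rfl⟩
        change _ ∈ (groupHomology.d₃₂ A).hom.toAddMonoidHom.range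
        exact ⟨Finsupp.single t (1 : ℤ), groupHomology.d₃₂_single (A := A) t (1 : ℤ)⟩
    rw [← h2]; rfl
  -- Homology and $\ker\pi$ are both quotients of the group of 2-cycles; it remains to see that the
  -- two kernels are the same group of boundaries.
  let P : Multiplicative (groupHomology.cycles₂ A) →* Multiplicative (SchurMultiplier H) :=
    AddMonoidHom.toMultiplicative (groupHomology.H2π A).hom.toAddMonoidHom
  let Q : Multiplicative (groupHomology.cycles₂ A) →* π.ker :=
    (((Subgroup.center E).subtype.comp (AddMonoidHom.toMultiplicativeLeft (f.comp j)))).codRestrict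
      _ fun x => hfπ _
  have hP : Function.Surjective P := fun y => by
    induction y using groupHomology.H2_induction_on with
    | h x => exact ⟨x, rfl⟩
  have hQ : Function.Surjective Q := fun k => by
    obtain ⟨x, hx, hk⟩ := hfs k k.2
    exact ⟨Multiplicative.ofAdd ⟨x, (hj x).mp hx⟩, Subtype.ext hk⟩
  have hPQ : P.ker = Q.ker := by
    ext x
    have h1 : x ∈ P.ker ↔ (j x.toAdd : H × H →₀ ℤ) ∈ groupHomology.boundaries₂ A :=
      groupHomology.H2π_eq_zero_iff (A := A) x.toAdd
    rw [h1, hB, ← hf0 (j x.toAdd) ((hj _).mpr x.toAdd.2), MonoidHom.mem_ker]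
    exact ⟨fun h => Subtype.ext (congrArg (fun z => (z.toMul : E)) h),
      fun h => Additive.toMul.injective (Subtype.ext (congrArg (fun z : π.ker => (z : E)) h))⟩
  exact ⟨(QuotientGroup.quotientKerEquivOfSurjective P hP).symm.trans
    ((QuotientGroup.quotientMulEquivOfEq hPQ).trans
      (QuotientGroup.quotientKerEquivOfSurjective Q hQ))⟩

/-! ### Carmichael's bound for the alternating group and its double cover -/

open scoped Nat in
/-- Carmichael's relations bound the order of the generated group by half a factorial. -/
theorem carmichael_card_le {G : Type*} [Group G] {m : ℕ} (v : Fin m → G) (h3 : ∀ i, v i ^ 3 = 1)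
    (h2 : ∀ i j, i ≠ j → (v i * v j) ^ 2 = 1) :
    Finite (Subgroup.closure (Set.range v)) ∧
      2 * Nat.card (Subgroup.closure (Set.range v)) ≤ (m + 2)! := by
  -- The model for `v i` is the three-cycle $(i\,a\,b)$ in $A_{m+2}$. Adding one generator should
  -- multiply the order by at most $m+3$, the index of $A_{m+2}$ in $A_{m+3}$.
  induction m with
  | zero =>
    rw [Set.range_eq_empty, Subgroup.closure_empty]
    exact ⟨inferInstance, by simp⟩
  | succ m ih =>
    obtain ⟨hfin, hcard⟩ := ih (fun i => v i.castSucc) (fun i => h3 _)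
      fun i j hij => h2 _ _ ((Fin.castSucc_injective m).ne hij)
    set S := Subgroup.closure (Set.range fun i : Fin m => v i.castSucc)
    have hS : ∀ i : Fin m, v i.castSucc ∈ S := fun i => Subgroup.subset_closure ⟨i, rfl⟩
    set w := v (Fin.last m) with hw
    have hinv : ∀ i, (v i)⁻¹ = v i * v i := fun i => by
      rw [inv_eq_iff_mul_eq_one, ← mul_assoc, ← pow_three', h3]
    have hww : w⁻¹ = w * w := hinv _
    have hswap : ∀ i j, i ≠ j → v i * v j = (v j)⁻¹ * (v i)⁻¹ := fun i j hij => by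
      rw [← mul_inv_rev, eq_inv_iff_mul_eq_one, ← pow_two, h2 i j hij]
    -- Candidates for representatives of the $m+3$ right cosets of `S`. The claim `key` says that
    -- right multiplication by any generator maps their union to itself, so they cover the whole
    -- group.
    let r : Fin m ⊕ Fin 3 → G := Sum.elim (fun i => w⁻¹ * v i.castSucc) ![1, w, w⁻¹]
    have hw2 : w⁻¹ * w⁻¹ = w := by rw [hww, ← mul_assoc, ← hww]; group
    have hv2 : ∀ i, (v i)⁻¹ * (v i)⁻¹ = v i := fun i => by rw [hinv, ← mul_assoc, ← hinv]; group
    have hcw : ∀ i : Fin m, w * v i.castSucc = (v i.castSucc)⁻¹ * w⁻¹ := fun i =>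
      hswap _ _ (Fin.castSucc_lt_last i).ne'
    have hwc : ∀ i : Fin m, v i.castSucc * w = w⁻¹ * (v i.castSucc)⁻¹ := fun i =>
      hswap _ _ (Fin.castSucc_lt_last i).ne
    have hwi : ∀ i : Fin m, w * (v i.castSucc)⁻¹ = (v i.castSucc)⁻¹ * (w⁻¹ * v i.castSucc) :=
      fun i => calc
        _ = w * v i.castSucc * ((v i.castSucc)⁻¹ * (v i.castSucc)⁻¹) := by group
        _ = _ := by rw [hcw, hv2, mul_assoc]
    have key : ∀ o j, ∃ h ∈ S, ∃ o', r o * v j = h * r o' := by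
      intro o j
      rcases o with i | k
      · induction j using Fin.lastCases with
        | last =>
          refine ⟨_, inv_mem (hS i), Sum.inl i, ?_⟩
          change w⁻¹ * v i.castSucc * w = (v i.castSucc)⁻¹ * (w⁻¹ * v i.castSucc)
          rw [mul_assoc, hwc, ← mul_assoc, hw2, hwi]
        | cast j =>
          by_cases hij : i = j
          · subst hij
            refine ⟨_, hS i, Sum.inr 1, ?_⟩
            change w⁻¹ * v i.castSucc * v i.castSucc = v i.castSucc * w
            rw [mul_assoc, ← hinv, hwc]
          · refine ⟨_, mul_mem (hS j) (inv_mem (hS i)), Sum.inl i, ?_⟩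
            change w⁻¹ * v i.castSucc * v j.castSucc =
              v j.castSucc * (v i.castSucc)⁻¹ * (w⁻¹ * v i.castSucc)
            rw [mul_assoc, hswap _ _ ((Fin.castSucc_injective m).ne hij), ← mul_assoc, ← hwc,
              mul_assoc, hwi, mul_assoc]
      · induction j using Fin.lastCases with
        | last =>
          fin_cases k
          · exact ⟨1, one_mem _, Sum.inr 1, rfl⟩
          · exact ⟨1, one_mem _, Sum.inr 2, by change w * w = 1 * w⁻¹; rw [one_mul, hww]⟩
          · exact ⟨1, one_mem _, Sum.inr 0, by change w⁻¹ * w = 1 * 1; group⟩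
        | cast j =>
          fin_cases k
          · exact ⟨_, hS j, Sum.inr 0, by change 1 * _ = _ * 1; group⟩
          · exact ⟨_, inv_mem (hS j), Sum.inr 2, hcw j⟩
          · exact ⟨1, one_mem _, Sum.inl j, (one_mul _).symm⟩
    have hcover : ∀ x ∈ Subgroup.closure (Set.range v), ∃ h ∈ S, ∃ o, x = h * r o := by
      have hstep : ∀ x j, (∃ h ∈ S, ∃ o, x = h * r o) → ∃ h ∈ S, ∃ o, x * v j = h * r o := by
        rintro x j ⟨h, hh, o, rfl⟩
        obtain ⟨h', hh', o', ho'⟩ := key o j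
        exact ⟨h * h', mul_mem hh hh', o', by rw [mul_assoc, ho', mul_assoc]⟩
      intro x hx
      induction hx using Subgroup.closure_induction_right with
      | one => exact ⟨1, one_mem _, Sum.inr 0, by simp [r]⟩
      | mul_right x hx y hy ih =>
        obtain ⟨j, rfl⟩ := hy
        exact hstep x j ih
      | mul_inv_cancel x hx y hy ih =>
        obtain ⟨j, rfl⟩ := hy
        rw [hinv, ← mul_assoc]
        exact hstep _ j (hstep x j ih)
    choose! h hh o ho using hcover
    let f : Subgroup.closure (Set.range v) → S × (Fin m ⊕ Fin 3) := fun x =>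
      (⟨h x, hh x x.2⟩, o x)
    have hf : Function.Injective f := fun x y hxy => by
      simp only [f, Prod.mk.injEq, Subtype.mk.injEq] at hxy
      exact Subtype.ext (by rw [ho x x.2, ho y y.2, hxy.1, hxy.2])
    refine ⟨Finite.of_injective f hf, ?_⟩
    have := Nat.card_le_card_of_injective f hf
    rw [Nat.card_prod, Nat.card_sum, Nat.card_fin, Nat.card_fin] at this
    rw [show m + 1 + 2 = (m + 2) + 1 by ring, Nat.factorial_succ]
    nlinarith

open scoped Nat in
/-- The variant of Carmichael's bound for generators whose products in pairs square to a central
involution. -/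
theorem carmichael_double_cover_card_le {G : Type*} [Group G] {m : ℕ} (v : Fin m → G) (z : G)
    (hv : Subgroup.closure (Set.range v) = ⊤) (hz : z ∈ Subgroup.center G) (hz2 : z * z = 1)
    (h3 : ∀ i, v i ^ 3 = 1) (h2 : ∀ i j, i ≠ j → (v i * v j) ^ 2 = z) :
    Finite G ∧ Nat.card G ≤ (m + 2)! := by
  -- Modulo $z$ the relations become Carmichael's; the factor $|Z|\le 2$ uses up the half in that
  -- bound.
  let Z := Subgroup.zpowers z
  have hZ : Z ≤ Subgroup.center G := by simpa [Z] using hz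
  have : Z.Normal := ⟨fun a ha b => by
    rwa [Subgroup.mem_center_iff.mp (hZ ha) b, mul_inv_cancel_right]⟩
  obtain ⟨h1, h4⟩ := carmichael_card_le (fun i => (QuotientGroup.mk (v i) : G ⧸ Z))
    (fun i => by rw [← QuotientGroup.mk_pow, h3, QuotientGroup.mk_one])
    (fun i j hij => by
      rw [← QuotientGroup.mk_mul, ← QuotientGroup.mk_pow, h2 i j hij, QuotientGroup.eq_one_iff]
      exact Subgroup.mem_zpowers z)
  have htop : Subgroup.closure (Set.range fun i => (QuotientGroup.mk (v i) : G ⧸ Z)) = ⊤ := by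
    rw [show (fun i => (QuotientGroup.mk (v i) : G ⧸ Z)) = QuotientGroup.mk' Z ∘ v from rfl,
      Set.range_comp, ← MonoidHom.map_closure, hv, ← MonoidHom.range_eq_map,
      MonoidHom.range_eq_top]
    exact QuotientGroup.mk'_surjective Z
  rw [htop] at h1 h4
  rw [Subgroup.card_top] at h4
  have h5 : Finite (G ⧸ Z) := Finite.of_equiv _ Subgroup.topEquiv.toEquiv
  have hfo : IsOfFinOrder z := isOfFinOrder_iff_pow_eq_one.mpr ⟨2, by norm_num, by rw [pow_two, hz2]⟩
  have h6 : Finite Z := hfo.finite_zpowers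
  have h7 : Nat.card Z ≤ 2 := by
    rw [Nat.card_zpowers]
    exact Nat.le_of_dvd (by norm_num) (orderOf_dvd_of_pow_eq_one (by rw [pow_two, hz2]))
  refine ⟨Finite.of_equiv _ (Subgroup.groupEquivQuotientProdSubgroup (s := Z)).symm, ?_⟩
  rw [Subgroup.card_eq_card_quotient_mul_card_subgroup Z]
  nlinarith

/-! ### Equivariant lifts to central extensions -/

open scoped IsMulCommutative in
/-- In a central extension `p : K → H`, lifts of the image of a perfect group commute with any
lift of an element that the image centralizes. -/
theorem IsCentralExtension.conj_eq_of_isPerfect {K H S : Type*} [Group K] [Group H] [Group S]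
    {p : K →* H} (hp : IsCentralExtension p) (hS : Group.IsPerfect S) (j : S →* H) (x : K)
    (hx : ∀ s, j s * p x = p x * j s) (s : S) (y : K) (hy : p y = j s) : y * x * y⁻¹ = x := by
  choose q hq using hp.surjective
  have hker : ∀ a b : K, p a = p b → a * b⁻¹ ∈ Subgroup.center K := fun a b hab =>
    hp.ker_le_center (by simp [MonoidHom.mem_ker, hab])
  have hc : ∀ s, ∀ y, p y = j s → y * x * y⁻¹ * x⁻¹ ∈ Subgroup.center K := fun s y hy =>
    hker _ _ (by simp [hy, hx])
  have hconj : ∀ a b : K, p a = p b → ∀ t, a * t * a⁻¹ = b * t * b⁻¹ := by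
    intro a b hab t
    have := Subgroup.mem_center_iff.mp (hker a b hab) (b * t * b⁻¹)
    calc a * t * a⁻¹ = (a * b⁻¹) * (b * t * b⁻¹) * (a * b⁻¹)⁻¹ := by group
      _ = _ := by rw [← this]; group
  -- The commutator of $x$ with a lift of $j(s)$ is central and does not depend on the lift, so it
  -- is multiplicative in $s$. Perfectness of $S$ makes it trivial.
  let χ : S →* Subgroup.center K := MonoidHom.mk' (fun s => ⟨_, hc s (q (j s)) (hq _)⟩) <| by
    intro a b
    ext
    change q (j (a * b)) * x * (q (j (a * b)))⁻¹ * x⁻¹ = (q (j a) * x * (q (j a))⁻¹ * x⁻¹) *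
      (q (j b) * x * (q (j b))⁻¹ * x⁻¹)
    rw [hconj (q (j (a * b))) (q (j a) * q (j b)) (by simp [hq])]
    have := Subgroup.mem_center_iff.mp (hc b (q (j b)) (hq _)) (q (j a))
    calc _ = q (j a) * (q (j b) * x * (q (j b))⁻¹ * x⁻¹) * x * (q (j a))⁻¹ * x⁻¹ := by group
      _ = (q (j b) * x * (q (j b))⁻¹ * x⁻¹) * (q (j a) * x * (q (j a))⁻¹ * x⁻¹) := by
          rw [this]; group
      _ = _ := (Subgroup.mem_center_iff.mp (hc b (q (j b)) (hq _)) _).symm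
  have h1 : q (j s) * x * (q (j s))⁻¹ * x⁻¹ = 1 := congrArg Subtype.val (hS.hom_eq_one χ s)
  rw [hconj y (q (j s)) (by rw [hy, hq])]
  exact mul_inv_eq_one.mp h1

theorem alternatingGroup_mul_smul {n k : ℕ} (a b : alternatingGroup (Fin n)) (s : Fin k ↪ Fin n) :
    (a * b) • s = a • b • s := rfl

/-- The alternating group of degree $n$ is $(n-2)$-fold transitive. -/
theorem alternatingGroup_exists_smul_eq {n k : ℕ} (hk : k + 2 ≤ n) (s t : Fin k ↪ Fin n) :
    ∃ a : alternatingGroup (Fin n), a • s = t := by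
  have h := alternatingGroup.isMultiplyPretransitive (Fin n)
  rw [Nat.card_fin] at h
  have h2 : MulAction.IsMultiplyPretransitive (alternatingGroup (Fin n)) (Fin n) k :=
    MulAction.isMultiplyPretransitive_of_le (n := n - 2) (by omega) (by simp)
  exact MulAction.isMultiplyPretransitive_iff.mp h2 s t

/-- An equivariant family of elements of `H` indexed by injective tuples lifts equivariantly to a
central extension of `H`. -/
theorem IsCentralExtension.exists_equivariant_lift {K H : Type*} [Group K] [Group H]
    {p : K →* H} (hp : IsCentralExtension p) {n k : ℕ} (hk : k + 5 ≤ n)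
    (ι : alternatingGroup (Fin n) →* H) (f : (Fin k ↪ Fin n) → H)
    (hf : ∀ (a : alternatingGroup (Fin n)) s, f (a • s) = ι a * f s * (ι a)⁻¹) :
    ∃ F : (Fin k ↪ Fin n) → K, (∀ s, p (F s) = f s) ∧
      ∀ (y : K) (a : alternatingGroup (Fin n)) s, p y = ι a → F (a • s) = y * F s * y⁻¹ := by
  choose q hq using hp.surjective
  let s₀ : Fin k ↪ Fin n := Fin.castLEEmb (by omega)
  choose a ha using fun s => alternatingGroup_exists_smul_eq (by omega) s₀ s
  -- The stabilizer of $s_0$ is the alternating group on the complement $X$, which has at least five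
  -- points and is therefore perfect. So lifts of the stabilizer commute with the chosen lift of
  -- $f(s_0)$.
  have hfix : ∀ (b : alternatingGroup (Fin n)) (y : K), b • s₀ = s₀ → p y = ι b →
      y * q (f s₀) * y⁻¹ = q (f s₀) := by
    intro b y hb hy
    let X := {i : Fin n // i ∉ Set.range s₀}
    have hX : Nat.card X = n - k := by
      rw [Nat.card_eq_fintype_card, Fintype.card_subtype_compl]
      have := Set.card_range_of_injective s₀.injective
      rw [Fintype.card_fin] at this
      rw [Fintype.card_fin]
      exact congrArg (n - ·) (by convert this)
    have hperf : Group.IsPerfect (alternatingGroup X) :=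
      ⟨commutator_alternatingGroup_eq_top (by omega)⟩
    let j : alternatingGroup X →* alternatingGroup (Fin n) :=
      ((Equiv.Perm.ofSubtype (p := fun i => i ∉ Set.range s₀)).comp
        (alternatingGroup X).subtype).codRestrict _ fun g => by
          have := g.2
          rw [Equiv.Perm.mem_alternatingGroup] at this ⊢
          simpa using this
    have hj : ∀ g, j g • s₀ = s₀ := by
      intro g
      ext i
      have : Equiv.Perm.ofSubtype (p := fun i => i ∉ Set.range s₀) (g : Equiv.Perm X) (s₀ i) =
        s₀ i := Equiv.Perm.ofSubtype_apply_of_not_mem _ (by simp)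
      exact congrArg Fin.val this
    have hbs : ∀ i, (b : Equiv.Perm (Fin n)) (s₀ i) = s₀ i := fun i => DFunLike.congr_fun hb i
    have hbX : ∀ i, (b : Equiv.Perm (Fin n)) i ∉ Set.range s₀ ↔ i ∉ Set.range s₀ := by
      intro i
      rw [not_iff_not]
      constructor
      · rintro ⟨l, hl⟩
        exact ⟨l, (b : Equiv.Perm (Fin n)).injective (by rw [hbs, hl])⟩
      · rintro ⟨l, rfl⟩
        exact ⟨l, (hbs l).symm⟩
    have hbg : Equiv.Perm.ofSubtype (p := fun i => i ∉ Set.range s₀) ((b : Equiv.Perm (Fin n)).subtypePerm hbX) = b :=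
      Equiv.Perm.ofSubtype_subtypePerm _ (by
        intro i hi
        rintro ⟨l, rfl⟩
        exact hi (hbs l))
    let g : alternatingGroup X := ⟨(b : Equiv.Perm (Fin n)).subtypePerm hbX, by
      rw [Equiv.Perm.mem_alternatingGroup, ← Equiv.Perm.sign_ofSubtype, hbg]
      exact b.2⟩
    have hjg : j g = b := Subtype.ext hbg
    refine hp.conj_eq_of_isPerfect hperf (ι.comp j) _ (fun l => ?_) g y (by simp [hy, hjg])
    have := hf (j l) s₀
    rw [hj] at this
    rw [hq, MonoidHom.comp_apply]
    exact (eq_mul_inv_iff_mul_eq.mp this).symm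
  refine ⟨fun s => q (ι (a s)) * q (f s₀) * (q (ι (a s)))⁻¹, fun s => ?_, fun y b s hy => ?_⟩
  · rw [map_mul, map_mul, map_inv, hq, hq, ← hf, ha]
  · have hinv : (a (b • s))⁻¹ • (b • s) = s₀ := by
      have h0 := congrArg ((a (b • s))⁻¹ • ·) (ha (b • s))
      simp only [← alternatingGroup_mul_smul, inv_mul_cancel] at h0
      exact h0.symm
    -- The two ways of reaching $b\cdot s$ from $s_0$, directly or through $s$, differ by an element
    -- of the stabilizer.
    have h1 := hfix ((a (b • s))⁻¹ * b * a s) ((q (ι (a (b • s))))⁻¹ * y * q (ι (a s)))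
      (by rw [alternatingGroup_mul_smul, alternatingGroup_mul_smul, ha, hinv]) (by simp [hq, hy])
    conv_lhs => rw [← h1]
    group

/-! ### Canonical lifts of three-cycles -/

/-- The injective triple with given distinct entries. -/
def tripleEmb {α : Type*} {i j k : α} (hij : i ≠ j) (hik : i ≠ k) (hjk : j ≠ k) : Fin 3 ↪ α :=
  ⟨![i, j, k], by
    intro a b
    fin_cases a <;> fin_cases b <;> simp [hij, hik, hjk, hij.symm, hik.symm, hjk.symm]⟩

/-- The injective quadruple with given distinct entries. -/
def quadrupleEmb {α : Type*} {i j k l : α} (hij : i ≠ j) (hik : i ≠ k) (hil : i ≠ l) (hjk : j ≠ k)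
    (hjl : j ≠ l) (hkl : k ≠ l) : Fin 4 ↪ α :=
  ⟨![i, j, k, l], by
    intro a b
    fin_cases a <;> fin_cases b <;>
      simp [hij, hik, hjk, hij.symm, hik.symm, hjk.symm, hil, hil.symm, hjl, hjl.symm, hkl,
        hkl.symm]⟩

theorem exists_alternatingGroup_apply_triple {n : ℕ} (hn : 5 ≤ n) {i j k i' j' k' : Fin n}
    (hij : i ≠ j) (hik : i ≠ k) (hjk : j ≠ k) (hij' : i' ≠ j') (hik' : i' ≠ k') (hjk' : j' ≠ k') :
    ∃ a : alternatingGroup (Fin n), (a : Equiv.Perm (Fin n)) i = i' ∧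
      (a : Equiv.Perm (Fin n)) j = j' ∧ (a : Equiv.Perm (Fin n)) k = k' := by
  obtain ⟨a, ha⟩ := alternatingGroup_exists_smul_eq (k := 3) (by omega) (tripleEmb hij hik hjk)
    (tripleEmb hij' hik' hjk')
  exact ⟨a, DFunLike.congr_fun ha 0, DFunLike.congr_fun ha 1, DFunLike.congr_fun ha 2⟩

theorem exists_alternatingGroup_apply_quadruple {n : ℕ} (hn : 6 ≤ n) {i j k l i' j' k' l' : Fin n}
    (hij : i ≠ j) (hik : i ≠ k) (hil : i ≠ l) (hjk : j ≠ k) (hjl : j ≠ l) (hkl : k ≠ l)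
    (hij' : i' ≠ j') (hik' : i' ≠ k') (hil' : i' ≠ l') (hjk' : j' ≠ k') (hjl' : j' ≠ l')
    (hkl' : k' ≠ l') :
    ∃ a : alternatingGroup (Fin n), (a : Equiv.Perm (Fin n)) i = i' ∧
      (a : Equiv.Perm (Fin n)) j = j' ∧ (a : Equiv.Perm (Fin n)) k = k' ∧
      (a : Equiv.Perm (Fin n)) l = l' := by
  obtain ⟨a, ha⟩ := alternatingGroup_exists_smul_eq (k := 4) (by omega)
    (quadrupleEmb hij hik hil hjk hjl hkl) (quadrupleEmb hij' hik' hil' hjk' hjl' hkl')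
  exact ⟨a, DFunLike.congr_fun ha 0, DFunLike.congr_fun ha 1, DFunLike.congr_fun ha 2,
    DFunLike.congr_fun ha 3⟩

-- In cycle notation `swap i a * swap a b` is $(i\,a\,b)$. The product being a double transposition,
-- $(t_it_j)^2$ is central for lifts $t_i$ of these cycles.
open Equiv in
theorem threeCycle_mul_threeCycle {α : Type*} [DecidableEq α] {i j a b : α} (hij : i ≠ j)
    (hia : i ≠ a) (hib : i ≠ b) (hja : j ≠ a) (hjb : j ≠ b) (hab : a ≠ b) :
    swap i a * swap a b * (swap j a * swap a b) = swap i a * swap j b := by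
  ext x
  simp only [Perm.mul_apply, swap_apply_def]
  split_ifs <;> simp_all

open Equiv in
/-- A set of even permutations that is closed under products and contains the three-cycles through
two fixed points contains every three-cycle. -/
theorem threeCycle_mem_of_star {α : Type*} [DecidableEq α] (M : Subgroup (Perm α)) {a b : α}
    (hab : a ≠ b) (hM : ∀ i, i ≠ a → i ≠ b → swap i a * swap a b ∈ M) {x y z : α} (hxy : x ≠ y)
    (hxz : x ≠ z) (hyz : y ≠ z) : swap x y * swap y z ∈ M := by
  have rot : ∀ {x y z : α}, x ≠ y → x ≠ z → y ≠ z → swap x y * swap y z ∈ M →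
      swap y z * swap z x ∈ M := by
    intro x y z h1 h2 h3 h
    convert h using 1
    ext t
    simp only [Perm.mul_apply, swap_apply_def]
    split_ifs <;> simp_all
  have inv : ∀ {x y z : α}, x ≠ y → x ≠ z → y ≠ z → swap x y * swap y z ∈ M →
      swap y x * swap x z ∈ M := by
    intro x y z h1 h2 h3 h
    convert inv_mem (rot h1 h2 h3 h) using 1
    ext t
    simp only [mul_inv_rev, swap_inv, Perm.mul_apply, swap_apply_def]
    split_ifs <;> simp_all
  have conj : ∀ {g : Perm α} {x y z : α}, g ∈ M → swap x y * swap y z ∈ M →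
      swap (g x) (g y) * swap (g y) (g z) ∈ M := by
    intro g x y z hg h
    have := mul_mem (mul_mem hg h) (inv_mem hg)
    rw [swap_apply_apply, swap_apply_apply]
    convert this using 1
    group
  -- Conjugating $(i\,a\,b)$ by $(j\,a\,b)$ gives $(i\,b\,j)$, and by its inverse $(i\,j\,a)$.
  -- Conjugating the latter by $(a\,k\,b)$ gives $(i\,j\,k)$.
  have hb : ∀ {i j : α}, i ≠ j → i ≠ a → i ≠ b → j ≠ a → j ≠ b → swap i j * swap j b ∈ M := by
    intro i j hij hia hib hja hjb
    have h := conj (hM j hja hjb) (hM i hia hib)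
    have h1 : (swap j a * swap a b) i = i := by
      simp [swap_apply_of_ne_of_ne, *]
    have h2 : (swap j a * swap a b) a = b := by
      simp [swap_apply_of_ne_of_ne, hjb.symm, hab.symm]
    have h3 : (swap j a * swap a b) b = j := by simp
    rw [h1, h2, h3] at h
    exact rot hib.symm hjb.symm hij (inv hib hij hjb.symm h)
  have ha : ∀ {i j : α}, i ≠ j → i ≠ a → i ≠ b → j ≠ a → j ≠ b → swap i j * swap j a ∈ M := by
    intro i j hij hia hib hja hjb
    have h := conj (inv_mem (hM j hja hjb)) (hM i hia hib)
    have h1 : (swap j a * swap a b)⁻¹ i = i := by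
      simp [swap_apply_of_ne_of_ne, *]
    have h2 : (swap j a * swap a b)⁻¹ a = j := by
      simp [swap_apply_of_ne_of_ne, *]
    have h3 : (swap j a * swap a b)⁻¹ b = a := by
      simp [swap_apply_of_ne_of_ne, hjb.symm, hab.symm]
    rwa [h1, h2, h3] at h
  have h0 : ∀ {i j k : α}, i ≠ j → i ≠ k → j ≠ k → i ≠ a → i ≠ b → j ≠ a → j ≠ b → k ≠ a →
      k ≠ b → swap i j * swap j k ∈ M := by
    intro i j k hij hik hjk hia hib hja hjb hka hkb
    have hg : swap a k * swap k b ∈ M := inv hka hkb hab (hM k hka hkb)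
    have h := conj hg (ha hij hia hib hja hjb)
    have h1 : (swap a k * swap k b) i = i := by
      simp [swap_apply_of_ne_of_ne, *]
    have h2 : (swap a k * swap k b) j = j := by
      simp [swap_apply_of_ne_of_ne, *]
    have h3 : (swap a k * swap k b) a = k := by
      simp [swap_apply_of_ne_of_ne, hka.symm, hab]
    rwa [h1, h2, h3] at h
  -- The cases record which of $x,y,z$ are $a$ or $b$; rotation and inversion bring each to one of
  -- the forms above.
  by_cases hxa : x = a
  · subst hxa
    by_cases hyb : y = b
    · subst hyb
      exact rot hxz.symm hyz.symm hxy (hM z hxz.symm hyz.symm)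
    by_cases hzb : z = b
    · subst hzb
      exact inv hxy.symm hyb hxz (hM y hxy.symm hyb)
    exact rot hxz.symm hyz.symm hxy (rot hyz hxy.symm hxz.symm
      (ha hyz hxy.symm hyb hxz.symm hzb))
  by_cases hxb : x = b
  · subst hxb
    by_cases hya : y = a
    · subst hya
      exact inv hab hyz hxz (rot hyz.symm hxz.symm hab (hM z hyz.symm hxz.symm))
    by_cases hza : z = a
    · subst hza
      exact rot hab hyz.symm hxy (rot hyz hxy.symm hab (hM y hya hxy.symm))
    exact rot hxz.symm hyz.symm hxy (rot hyz hxy.symm hxz.symm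
      (hb hyz hya hxy.symm hza hxz.symm))
  by_cases hya : y = a
  · subst hya
    by_cases hzb : z = b
    · subst hzb
      exact hM x hxa hxb
    exact rot hxz.symm hyz.symm hxy (ha hxz.symm hyz.symm hzb hxa hxb)
  by_cases hyb : y = b
  · subst hyb
    by_cases hza : z = a
    · subst hza
      exact rot hxz.symm hab hxy (inv hxz hxy hab (hM x hxz hxy))
    exact rot hxz.symm hyz.symm hxy (hb hxz.symm hza hyz.symm hxa hxb)
  by_cases hza : z = a
  · subst hza
    exact ha hxy hxa hxb hya hyb
  by_cases hzb : z = b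
  · subst hzb
    exact hb hxy hxa hxb hya hyb
  exact h0 hxy hxz hyz hxa hxb hya hyb hza hzb

-- The square of a three-cycle is its inverse, and exchanging two entries inverts it.
open Equiv in
theorem threeCycle_mul_self {α : Type*} [DecidableEq α] {i j k : α} (hij : i ≠ j) (hik : i ≠ k)
    (hjk : j ≠ k) : swap i j * swap j k * (swap i j * swap j k) = swap j i * swap i k := by
  ext t
  simp only [Perm.mul_apply, swap_apply_def]
  split_ifs <;> simp_all

open Equiv in
theorem swap_mul_swap_mul_self {α : Type*} [DecidableEq α] {i j a b : α} (hij : i ≠ j)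
    (hia : i ≠ a) (hib : i ≠ b) (hja : j ≠ a) (hjb : j ≠ b) (hab : a ≠ b) :
    swap i a * swap j b * (swap i a * swap j b) = 1 := by
  ext t
  simp only [Perm.mul_apply, swap_apply_def]
  split_ifs <;> simp_all

/-- In a central extension of the alternating group of degree at least `8`, the three-cycles have
canonical lifts, which satisfy the relations of Carmichael's generators up to a central
involution. -/
theorem IsCentralExtension.exists_threeCycle_lift {K : Type*} [Group K] {n : ℕ} (hn : 8 ≤ n)
    {p : K →* alternatingGroup (Fin n)} (hp : IsCentralExtension p) :
    ∃ (T : Fin n → Fin n → Fin n → K) (z : K), z ∈ Subgroup.center K ∧ z * z = 1 ∧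
      (∀ i j k, i ≠ j → i ≠ k → j ≠ k → T i j k ^ 3 = 1 ∧
        (p (T i j k) : Equiv.Perm (Fin n)) = Equiv.swap i j * Equiv.swap j k) ∧
      ∀ i j a b, i ≠ j → i ≠ a → i ≠ b → j ≠ a → j ≠ b → a ≠ b →
        (T i a b * T j a b) ^ 2 = z := by
  classical
  let f : (Fin 3 ↪ Fin n) → alternatingGroup (Fin n) := fun s =>
    ⟨Equiv.swap (s 0) (s 1) * Equiv.swap (s 1) (s 2), by
      rw [Equiv.Perm.mem_alternatingGroup, map_mul,
        Equiv.Perm.sign_swap (s.injective.ne (by decide)),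
        Equiv.Perm.sign_swap (s.injective.ne (by decide))]
      rfl⟩
  obtain ⟨F, hF, hconj⟩ := hp.exists_equivariant_lift (k := 3) (by omega) (MonoidHom.id _) f <| by
    intro a s
    apply Subtype.ext
    change Equiv.swap ((a : Equiv.Perm (Fin n)) (s 0)) ((a : Equiv.Perm (Fin n)) (s 1)) *
      Equiv.swap ((a : Equiv.Perm (Fin n)) (s 1)) ((a : Equiv.Perm (Fin n)) (s 2)) =
        (a : Equiv.Perm (Fin n)) * (Equiv.swap (s 0) (s 1) * Equiv.swap (s 1) (s 2)) *
        (a : Equiv.Perm (Fin n))⁻¹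
    rw [Equiv.swap_apply_apply, Equiv.swap_apply_apply]
    group
  let T₀ : Fin n → Fin n → Fin n → K := fun i j k =>
    if h : i ≠ j ∧ i ≠ k ∧ j ≠ k then F (tripleEmb h.1 h.2.1 h.2.2) else 1
  have hT₀p : ∀ i j k, i ≠ j → i ≠ k → j ≠ k →
      (p (T₀ i j k) : Equiv.Perm (Fin n)) = Equiv.swap i j * Equiv.swap j k := by
    intro i j k hij hik hjk
    simp only [T₀]
    rw [dif_pos ⟨hij, hik, hjk⟩, hF]
    rfl
  have hT₀c : ∀ y i j k, i ≠ j → i ≠ k → j ≠ k → T₀ ((p y : Equiv.Perm (Fin n)) i)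
      ((p y : Equiv.Perm (Fin n)) j) ((p y : Equiv.Perm (Fin n)) k) = y * T₀ i j k * y⁻¹ := by
    intro y i j k hij hik hjk
    simp only [T₀]
    have inj := (p y : Equiv.Perm (Fin n)).injective
    rw [dif_pos ⟨inj.ne hij, inj.ne hik, inj.ne hjk⟩, dif_pos ⟨hij, hik, hjk⟩,
      ← hconj y (p y) _ rfl]
    congr 1
    ext l
    fin_cases l <;> rfl
  -- The defect $c$ is computed at one triple and carried to all others by conjugation, which fixes
  -- it because it is central.
  obtain ⟨c, hcp, hT₀s⟩ : ∃ c ∈ p.ker, ∀ i j k, i ≠ j → i ≠ k → j ≠ k →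
      T₀ j i k = c * T₀ i j k ^ 2 := by
    have h01 : (⟨0, by omega⟩ : Fin n) ≠ ⟨1, by omega⟩ := by simp
    have h02 : (⟨0, by omega⟩ : Fin n) ≠ ⟨2, by omega⟩ := by simp
    have h12 : (⟨1, by omega⟩ : Fin n) ≠ ⟨2, by omega⟩ := by simp
    set a : Fin n := ⟨0, by omega⟩
    set b : Fin n := ⟨1, by omega⟩
    set d : Fin n := ⟨2, by omega⟩
    have hc : T₀ b a d * (T₀ a b d ^ 2)⁻¹ ∈ p.ker := by
      rw [MonoidHom.mem_ker, map_mul, map_inv, mul_inv_eq_one, map_pow]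
      apply Subtype.ext
      rw [Subgroup.coe_pow, hT₀p _ _ _ h01 h02 h12, hT₀p _ _ _ h01.symm h12 h02, pow_two,
        threeCycle_mul_self h01 h02 h12]
    refine ⟨_, hc, fun i j k hij hik hjk => ?_⟩
    obtain ⟨g, rfl, rfl, rfl⟩ := exists_alternatingGroup_apply_triple (by omega) h01 h02 h12
      hij hik hjk
    obtain ⟨y, rfl⟩ := hp.surjective g
    rw [hT₀c _ _ _ _ h01 h02 h12, hT₀c _ _ _ _ h01.symm h12 h02]
    have := Subgroup.mem_center_iff.mp (hp.ker_le_center hc) y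
    calc y * T₀ b a d * y⁻¹ = y * (T₀ b a d * (T₀ a b d ^ 2)⁻¹) * T₀ a b d ^ 2 * y⁻¹ := by group
      _ = _ := by rw [this, conj_pow]; group
  have hcc : ∀ x, x * c = c * x := fun x => Subgroup.mem_center_iff.mp (hp.ker_le_center hcp) x
  rw [MonoidHom.mem_ker] at hcp
  -- This scaling absorbs the defect: $T_{jik}=c\cdot cT_{0,ijk}^2=T_{ijk}^2$. Applying the relation
  -- twice gives $T^4=T$, so $T^3=1$.
  let T : Fin n → Fin n → Fin n → K := fun i j k => c * T₀ i j k
  have hTp : ∀ i j k, i ≠ j → i ≠ k → j ≠ k →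
      (p (T i j k) : Equiv.Perm (Fin n)) = Equiv.swap i j * Equiv.swap j k := by
    intro i j k hij hik hjk
    simp only [T]
    rw [map_mul, hcp, one_mul, hT₀p i j k hij hik hjk]
  have hTc : ∀ y i j k, i ≠ j → i ≠ k → j ≠ k → T ((p y : Equiv.Perm (Fin n)) i)
      ((p y : Equiv.Perm (Fin n)) j) ((p y : Equiv.Perm (Fin n)) k) = y * T i j k * y⁻¹ := by
    intro y i j k hij hik hjk
    simp only [T]
    rw [hT₀c y i j k hij hik hjk, ← mul_assoc y, hcc y]
    group
  have hTs : ∀ i j k, i ≠ j → i ≠ k → j ≠ k → T j i k = T i j k ^ 2 := by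
    intro i j k hij hik hjk
    simp only [T]
    rw [hT₀s i j k hij hik hjk, pow_two (c * _), mul_assoc c (T₀ i j k), ← mul_assoc (T₀ i j k) c,
      hcc (T₀ i j k), pow_two]
    group
  have hT3 : ∀ i j k, i ≠ j → i ≠ k → j ≠ k → T i j k ^ 3 = 1 := by
    intro i j k hij hik hjk
    have h1 := hTs j i k hij.symm hjk hik
    rw [hTs i j k hij hik hjk, ← pow_mul] at h1
    have : T i j k ^ 3 * T i j k = 1 * T i j k := by
      rw [← pow_succ, one_mul]; exact h1.symm
    exact mul_right_cancel this
  have hTi : ∀ i j k, i ≠ j → i ≠ k → j ≠ k → (T i j k)⁻¹ = T j i k := by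
    intro i j k hij hik hjk
    rw [hTs i j k hij hik hjk, inv_eq_iff_mul_eq_one, ← pow_succ', hT3 i j k hij hik hjk]
  have hTr : ∀ i j k, i ≠ j → i ≠ k → j ≠ k → T j k i = T i j k := by
    intro i j k hij hik hjk
    -- The lift conjugates itself to itself, while its image rotates the triple.
    have h1 := hTc (T i j k) i j k hij hik hjk
    rw [hTp i j k hij hik hjk] at h1
    simp only [Equiv.Perm.mul_apply, Equiv.swap_apply_left, Equiv.swap_apply_right,
      Equiv.swap_apply_of_ne_of_ne hij hik, Equiv.swap_apply_of_ne_of_ne hik.symm hjk.symm] at h1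
    rw [h1]; group
  have hZker : ∀ i j a b, i ≠ j → i ≠ a → i ≠ b → j ≠ a → j ≠ b → a ≠ b →
      (T i a b * T j a b) ^ 2 ∈ Subgroup.center K := by
    intro i j a b hij hia hib hja hjb hab
    apply hp.ker_le_center
    rw [MonoidHom.mem_ker, map_pow, map_mul]
    apply Subtype.ext
    rw [Subgroup.coe_pow, Subgroup.coe_mul, hTp _ _ _ hia hib hab, hTp _ _ _ hja hjb hab,
      threeCycle_mul_threeCycle hij hia hib hja hjb hab, pow_two,
      swap_mul_swap_mul_self hij hia hib hja hjb hab]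
    rfl
  obtain ⟨z, hz, hTz⟩ : ∃ z ∈ Subgroup.center K, ∀ i j a b, i ≠ j → i ≠ a → i ≠ b → j ≠ a →
      j ≠ b → a ≠ b → (T i a b * T j a b) ^ 2 = z := by
    let s : Fin 4 ↪ Fin n := Fin.castLEEmb (by omega)
    have hs : ∀ {a b : Fin 4}, a ≠ b → s a ≠ s b := fun h => s.injective.ne h
    have h01 : s 0 ≠ s 1 := hs (by decide)
    have h02 : s 0 ≠ s 2 := hs (by decide)
    have h03 : s 0 ≠ s 3 := hs (by decide)
    have h12 : s 1 ≠ s 2 := hs (by decide)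
    have h13 : s 1 ≠ s 3 := hs (by decide)
    have h23 : s 2 ≠ s 3 := hs (by decide)
    have hz := hZker _ _ _ _ h01 h02 h03 h12 h13 h23
    refine ⟨_, hz, fun i j a b hij hia hib hja hjb hab => ?_⟩
    obtain ⟨g, rfl, rfl, rfl, rfl⟩ := exists_alternatingGroup_apply_quadruple (by omega)
      h01 h02 h03 h12 h13 h23 hij hia hib hja hjb hab
    obtain ⟨y, rfl⟩ := hp.surjective g
    rw [hTc _ _ _ _ h02 h03 h23, hTc _ _ _ _ h12 h13 h23]
    have := Subgroup.mem_center_iff.mp hz y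
    calc _ = y * (T (s 0) (s 2) (s 3) * T (s 1) (s 2) (s 3)) ^ 2 * y⁻¹ := by
          simp only [pow_two]; group
      _ = _ := by rw [this]; group
  refine ⟨T, z, hz, ?_, fun i j k hij hik hjk => ⟨hT3 i j k hij hik hjk, hTp i j k hij hik hjk⟩,
    hTz⟩
  let s : Fin 4 ↪ Fin n := Fin.castLEEmb (by omega)
  have hs : ∀ {a b : Fin 4}, a ≠ b → s a ≠ s b := fun h => s.injective.ne h
  have h01 : s 0 ≠ s 1 := hs (by decide)
  have h02 : s 0 ≠ s 2 := hs (by decide)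
  have h03 : s 0 ≠ s 3 := hs (by decide)
  have h12 : s 1 ≠ s 2 := hs (by decide)
  have h13 : s 1 ≠ s 3 := hs (by decide)
  have h23 : s 2 ≠ s 3 := hs (by decide)
  have h := hTz _ _ _ _ h01 h02 h03 h12 h13 h23
  have h' := hTz _ _ _ _ h01.symm h13 h12 h03 h02 h23.symm
  -- Inverting $T_{iab}T_{jab}$ gives $T_{jba}T_{iba}$, a product of the same kind, whose square is
  -- again $z$. Hence $z^{-1}=z$.
  have h'' : ((T (s 0) (s 2) (s 3) * T (s 1) (s 2) (s 3)) ^ 2)⁻¹ = z := by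
    rw [← inv_pow, mul_inv_rev, hTi _ _ _ h12 h13 h23, hTi _ _ _ h02 h03 h23,
      ← hTr _ _ _ h12.symm h23 h13, ← hTr _ _ _ h02.symm h23 h03, h']
  rw [h] at h''
  nth_rewrite 1 [← h'']
  exact inv_mul_cancel z

/-- The three-cycles through two fixed points generate the alternating group. -/
theorem alternatingGroup_subgroup_eq_top_of_star {n : ℕ} (M : Subgroup (alternatingGroup (Fin n)))
    {a b : Fin n} (hab : a ≠ b)
    (hM : ∀ i, i ≠ a → i ≠ b → ∃ g ∈ M, (g : Equiv.Perm (Fin n)) =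
      Equiv.swap i a * Equiv.swap a b) : M = ⊤ := by
  let M' := M.map (alternatingGroup (Fin n)).subtype
  have hM' : ∀ i, i ≠ a → i ≠ b → Equiv.swap i a * Equiv.swap a b ∈ M' := by
    intro i hia hib
    obtain ⟨g, hg, h⟩ := hM i hia hib
    exact ⟨g, hg, h⟩
  have hle : alternatingGroup (Fin n) ≤ M' := by
    rw [← Equiv.Perm.closure_three_cycles_eq_alternating, Subgroup.closure_le]
    intro g hg
    obtain ⟨x, hx⟩ := hg.isCycle.nonempty_support
    have hnd := hg.nodup_iff_mem_support.mpr hx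
    simp only [List.nodup_cons, List.mem_cons, List.not_mem_nil, or_false, not_or] at hnd
    rw [hg.eq_swap_mul_swap_iff_mem_support.mpr hx]
    exact threeCycle_mem_of_star M' hab hM' hnd.1.1 hnd.1.2 hnd.2.1
  rw [eq_top_iff]
  intro g _
  obtain ⟨g', hg', h⟩ := hle g.2
  rwa [← Subtype.ext h]

/-! ### Lifting double covers of the alternating group to central extensions -/

/-- Any double cover of the alternating group of degree at least `8` in which the lifts of double
transpositions have order `4` maps to every central extension. -/
theorem IsCentralExtension.exists_lift_of_double_cover {S K : Type*} [Group S] [Group K] {n : ℕ}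
    (hn : 8 ≤ n) {σ : S →* alternatingGroup (Fin n)} (hσ : Function.Surjective σ) {ε : S}
    (hε : ε ≠ 1) (hker : ∀ x, σ x = 1 ↔ x = 1 ∨ x = ε)
    (hsq : ∀ x i j a b, i ≠ j → i ≠ a → i ≠ b → j ≠ a → j ≠ b → a ≠ b →
      (σ x : Equiv.Perm (Fin n)) = Equiv.swap i a * Equiv.swap j b → x ^ 2 = ε)
    {p : K →* alternatingGroup (Fin n)} (hp : IsCentralExtension p) :
    ∃ φ : S →* K, p.comp φ = σ := by
  have hσε : σ ε = 1 := (hker ε).mpr (Or.inr rfl)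
  have hεc : ε ∈ Subgroup.center S := Subgroup.mem_center_iff.mpr fun x => by
    have h1 : σ (x * ε * x⁻¹) = 1 := by simp [hσε]
    rcases (hker _).mp h1 with h | h
    · exact absurd (by simpa using h) hε
    · exact mul_inv_eq_iff_eq_mul.mp h
  -- In the fibre product a lift $S\to K$ appears as a subgroup projecting isomorphically to $S$.
  -- The canonical lifts of three-cycles generate such a subgroup `G`.
  let D : Subgroup (K × S) := (p.comp (MonoidHom.fst K S)).eqLocus (σ.comp (MonoidHom.snd K S))
  have hD : ∀ x : D, p x.1.1 = σ x.1.2 := fun x => x.2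
  let q : D →* alternatingGroup (Fin n) := (σ.comp (MonoidHom.snd K S)).comp D.subtype
  have hq : IsCentralExtension q := by
    refine ⟨fun g => ?_, fun x hx => Subgroup.mem_center_iff.mpr fun y => ?_⟩
    · obtain ⟨k, hk⟩ := hp.surjective g
      obtain ⟨s, hs⟩ := hσ g
      exact ⟨⟨(k, s), hk.trans hs.symm⟩, hs⟩
    · have hx : σ x.1.2 = 1 := hx
      refine Subtype.ext (Prod.ext ?_ ?_)
      · exact Subgroup.mem_center_iff.mp (hp.ker_le_center ((hD x).trans hx)) _
      · refine Subgroup.mem_center_iff.mp ?_ _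
        rcases (hker _).mp hx with h | h
        · rw [h]; exact one_mem _
        · rw [h]; exact hεc
  obtain ⟨T, z, hz, hz2, hT, hTz⟩ := hq.exists_threeCycle_lift hn
  obtain ⟨m, rfl⟩ : ∃ m, n = m + 2 := ⟨n - 2, by omega⟩
  let a : Fin (m + 2) := Fin.last (m + 1)
  let b : Fin (m + 2) := (Fin.last m).castSucc
  have hba : b ≠ a := (Fin.castSucc_lt_last _).ne
  let ι : Fin m → Fin (m + 2) := fun i => i.castSucc.castSucc
  have hιa : ∀ i, ι i ≠ a := fun i => (Fin.castSucc_lt_last _).ne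
  have hιb : ∀ i, ι i ≠ b := fun i => (Fin.castSucc_injective _).ne (Fin.castSucc_lt_last _).ne
  have hι : Function.Injective ι := (Fin.castSucc_injective _).comp (Fin.castSucc_injective _)
  have hιs : ∀ i, i ≠ a → i ≠ b → ∃ j, ι j = i := by
    intro i hia hib
    induction i using Fin.lastCases with
    | last => exact absurd rfl hia
    | cast i =>
      induction i using Fin.lastCases with
      | last => exact absurd rfl hib
      | cast i => exact ⟨i, rfl⟩
  let v : Fin m → D := fun i => T (ι i) a b
  let G := Subgroup.closure (Set.range v)
  have hvG : ∀ i, v i ∈ G := fun i => Subgroup.subset_closure ⟨i, rfl⟩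
  have hv2 : ∀ i j, i ≠ j → (v i * v j) ^ 2 = z := fun i j hij =>
    hTz _ _ _ _ (hι.ne hij) (hιa i) (hιb i) (hιa j) (hιb j) hba.symm
  have hm : 1 < m := by omega
  let i0 : Fin m := ⟨0, by omega⟩
  let i1 : Fin m := ⟨1, hm⟩
  have hi01 : i0 ≠ i1 := by simp [i0, i1]
  have hzG : z ∈ G := by
    rw [← hv2 i0 i1 hi01]
    exact pow_mem (mul_mem (hvG _) (hvG _)) 2
  -- The $S$-component of $z$ is the square of a lift of a double transposition. This is where the
  -- hypothesis on squares enters; it puts $\varepsilon$ in the image of `G`.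
  have hzε : z.1.2 = ε := by
    rw [← hv2 i0 i1 hi01]
    refine hsq _ (ι i0) (ι i1) a b (hι.ne hi01) (hιa _) (hιb _) (hιa _) (hιb _) hba.symm ?_
    rw [← threeCycle_mul_threeCycle (hι.ne hi01) (hιa _) (hιb _) (hιa _) (hιb _) hba.symm]
    have h1 := (hT _ _ _ (hιa i0) (hιb i0) hba.symm).2
    have h2 := (hT _ _ _ (hιa i1) (hιb i1) hba.symm).2
    rw [← h1, ← h2, ← Subgroup.coe_mul, ← map_mul]
    rfl
  let v' : Fin m → G := fun i => ⟨v i, hvG i⟩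
  have hv'top : Subgroup.closure (Set.range v') = ⊤ := by
    apply Subgroup.map_injective G.subtype_injective
    rw [MonoidHom.map_closure, ← Set.range_comp, ← MonoidHom.range_eq_map, Subgroup.range_subtype]
    rfl
  obtain ⟨hfin, hcard⟩ := carmichael_double_cover_card_le v' ⟨z, hzG⟩ hv'top
    (Subgroup.mem_center_iff.mpr fun g => Subtype.ext (Subgroup.mem_center_iff.mp hz g))
    (Subtype.ext hz2) (fun i => Subtype.ext (hT _ _ _ (hιa i) (hιb i) hba.symm).1)
    (fun i j hij => Subtype.ext (hv2 i j hij))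
  let π : G →* S := (MonoidHom.snd K S).comp (D.subtype.comp G.subtype)
  have hπ : Function.Surjective π := by
    have htop := alternatingGroup_subgroup_eq_top_of_star (G.map q) hba.symm <| by
      intro i hia hib
      obtain ⟨j, rfl⟩ := hιs i hia hib
      exact ⟨_, ⟨v j, hvG j, rfl⟩, (hT _ _ _ hia hib hba.symm).2⟩
    intro s
    obtain ⟨g, hg, hgs⟩ : σ s ∈ G.map q := by rw [htop]; trivial
    have hgs : σ g.1.2 = σ s := hgs
    have h1 : σ (g.1.2⁻¹ * s) = 1 := by rw [map_mul, map_inv, hgs, inv_mul_cancel]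
    rcases (hker _).mp h1 with h | h
    · exact ⟨⟨g, hg⟩, inv_mul_eq_one.mp h⟩
    · refine ⟨⟨g, hg⟩ * ⟨z, hzG⟩, ?_⟩
      rw [inv_mul_eq_iff_eq_mul] at h
      rw [h, ← hzε]
      rfl
  have hcardS : Nat.card S = Nat.factorial (m + 2) := by
    rw [← Subgroup.card_mul_index σ.ker, Subgroup.index_ker, MonoidHom.range_eq_top.mpr hσ,
      Subgroup.card_top]
    have h2 : Nat.card σ.ker = 2 := by
      rw [show Nat.card σ.ker = Set.ncard (σ.ker : Set S) from rfl,
        show (σ.ker : Set S) = {1, ε} from Set.ext fun x => hker x, Set.ncard_pair hε.symm]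
    have : Nontrivial (Fin (m + 2)) := inferInstance
    rw [h2, two_mul_nat_card_alternatingGroup, Nat.card_perm, Nat.card_fin]
  -- Carmichael's bound gives $|G|\le n!=|S|$, so the surjection onto $S$ is injective.
  have hbij : Function.Bijective π := by
    refine Function.Surjective.bijective_of_nat_card_le hπ ?_
    rw [hcardS]; exact hcard
  let e := MulEquiv.ofBijective π hbij
  refine ⟨((MonoidHom.fst K S).comp (D.subtype.comp G.subtype)).comp e.symm.toMonoidHom, ?_⟩
  ext1 s
  obtain ⟨g, rfl⟩ := e.surjective s
  simp only [MonoidHom.comp_apply, MulEquiv.coe_toMonoidHom, MulEquiv.symm_apply_apply]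
  exact hD g.1

namespace Hyperoctahedral

/-! ### The structure of the group of Clifford words -/

namespace CliffordWord

variable {n : ℕ}

theorem neg_mem_center (n : ℕ) : neg n ∈ Subgroup.center (CliffordWord n) := by
  rw [Subgroup.mem_center_iff]
  have h : (MulAut.conj (neg n)).toMonoidHom = MonoidHom.id (CliffordWord n) :=
    hom_ext (by simp) fun i => by
      simp [neg_mul_e]
  intro w
  have := DFunLike.congr_fun h w
  simp only [MulEquiv.coe_toMonoidHom, MulAut.conj_apply, MonoidHom.id_apply] at this
  exact (mul_inv_eq_iff_eq_mul.mp this).symm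

/-- A Clifford word with trivial image in `F_2^n` is `±1`. -/
theorem eq_one_or_eq_neg_of_toVec_eq_one {w : CliffordWord n} (hw : toVec n w = 1) :
    w = 1 ∨ w = neg n := by
  let Z := Subgroup.zpowers (neg n)
  have hZ : Z.Normal := ⟨fun a ha b => by
    have : Z ≤ Subgroup.center _ := by simpa [Z] using neg_mem_center n
    rwa [Subgroup.mem_center_iff.mp (this ha) b, mul_inv_cancel_right]⟩
  let q := QuotientGroup.mk' Z
  have hqneg : q (neg n) = 1 := (QuotientGroup.eq_one_iff _).mpr (Subgroup.mem_zpowers _)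
  have hee : ∀ i j : Fin n, q (e i) * q (e j) = q (e j) * q (e i) := by
    intro i j
    by_cases hij : i = j
    · rw [hij]
    · rw [← map_mul, e_mul_e hij, map_mul, map_mul, hqneg, one_mul]
  have hew : ∀ (i : Fin n) w, q (e i) * q w = q w * q (e i) := by
    intro i w
    have h : (MulAut.conj (q (e i))).toMonoidHom.comp q = q :=
      hom_ext (by simp [hqneg]) fun j => by simp [hee i j]
    have := DFunLike.congr_fun h w
    exact mul_inv_eq_iff_eq_mul.mp this
  have hww : ∀ x w, q x * q w = q w * q x := by
    intro x w
    have h : (MulAut.conj (q x)).toMonoidHom.comp q = q :=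
      hom_ext (by simp [hqneg]) fun j => by simp [← hew j x]
    have := DFunLike.congr_fun h w
    exact mul_inv_eq_iff_eq_mul.mp this
  let : CommGroup (CliffordWord n ⧸ Z) :=
    { (inferInstance : Group (CliffordWord n ⧸ Z)) with
      mul_comm := fun a b => by
        obtain ⟨x, rfl⟩ := QuotientGroup.mk'_surjective Z a
        obtain ⟨y, rfl⟩ := QuotientGroup.mk'_surjective Z b
        exact hww x y }
  have hsq : ∀ i : Fin n, q (e i) ^ 2 = 1 := fun i => by rw [pow_two, ← map_mul, e_sq, hqneg]
  -- Modulo $-1$ the symbols commute and square to $1$, so the quotient receives a map from $\mathbb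
  -- F_2^n$. The quotient map then factors through `toVec`, whose kernel must lie in $Z$.
  let f : Multiplicative (Fin n → ZMod 2) →* CliffordWord n ⧸ Z :=
    MonoidHom.mk' (fun v => ∏ i, q (e i) ^ (v.toAdd i).val) fun v v' => by
      rw [← Finset.prod_mul_distrib]
      refine Finset.prod_congr rfl fun i _ => ?_
      rw [← pow_add, toAdd_mul, Pi.add_apply, ZMod.val_add, ← pow_eq_pow_mod _ (hsq i)]
  have hf : f.comp (toVec n) = q := by
    refine hom_ext (by simp [hqneg]) fun i => ?_
    simp only [MonoidHom.comp_apply, toVec_e, f, MonoidHom.mk'_apply, toAdd_ofAdd]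
    rw [Finset.prod_eq_single i]
    · rw [Pi.single_eq_same, ZMod.val_one, pow_one]
    · intro j _ hj
      simp [hj]
    · simp
  have h1 : q w = 1 := by
    rw [← hf, MonoidHom.comp_apply, hw, map_one]
  obtain ⟨k, rfl⟩ := Subgroup.mem_zpowers_iff.mp ((QuotientGroup.eq_one_iff _).mp h1)
  have h2 : neg n ^ (2 : ℤ) = 1 := by rw [zpow_two, neg_sq]
  rcases Int.even_or_odd' k with ⟨l, rfl | rfl⟩
  · left; rw [zpow_mul, h2, one_zpow]
  · right; rw [zpow_add, zpow_mul, h2, one_zpow, one_mul, zpow_one]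

theorem toVec_surjective (n : ℕ) : Function.Surjective (toVec n) := by
  intro v
  rw [← MonoidHom.mem_range]
  have h : v = ∏ i, Multiplicative.ofAdd (Pi.single i (v.toAdd i)) := by
    rw [← ofAdd_sum, Finset.univ_sum_single]; rfl
  rw [h]
  refine Subgroup.prod_mem _ fun i _ => ?_
  obtain h0 | h1 : v.toAdd i = 0 ∨ v.toAdd i = 1 := by
    generalize v.toAdd i = x
    revert x; decide
  · rw [h0, Pi.single_zero]; exact one_mem _
  · rw [h1]; exact ⟨e i, toVec_e i⟩

theorem eq_or_eq_neg_mul_of_toVec_eq {x y : CliffordWord n} (h : toVec n x = toVec n y) :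
    x = y ∨ x = neg n * y := by
  have h1 : toVec n (x * y⁻¹) = 1 := by rw [map_mul, map_inv, h, mul_inv_cancel]
  rcases eq_one_or_eq_neg_of_toVec_eq_one h1 with h | h
  · exact Or.inl (mul_inv_eq_one.mp h)
  · exact Or.inr (mul_inv_eq_iff_eq_mul.mp h)

/-- Moving $e_l$ past $e_j$ costs a sign, which $e_l^2=-1$ cancels. Thus the products $e_ie_l$ with
$l$ fixed again satisfy the Clifford relations. -/
theorem e_mul_e_mul_e_mul_e (i : Fin n) {j l : Fin n} (hjl : j ≠ l) :
    e i * e l * (e j * e l) = e i * e j := by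
  have hc := Subgroup.mem_center_iff.mp (neg_mem_center n)
  calc _ = e i * (e l * e j * e l) := by simp only [mul_assoc]
    _ = e i * (neg n * e j * (e l * e l)) := by rw [e_mul_e hjl.symm]; simp only [mul_assoc]
    _ = _ := by rw [e_sq, hc, ← mul_assoc (neg n), neg_sq, one_mul]

/-- The homomorphism `F_n → F_{n+1}` sending `e_i` to `e_i e_n`. -/
def shift (n : ℕ) : CliffordWord n →* CliffordWord (n + 1) :=
  lift (neg (n + 1)) (fun i => e i.castSucc * e (Fin.last n)) (neg_sq _)
    (fun i => by rw [Subgroup.mem_center_iff.mp (neg_mem_center (n + 1))])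
    (fun i => by rw [e_mul_e_mul_e_mul_e _ (Fin.castSucc_lt_last i).ne, e_sq])
    (fun i j hij => by
      rw [e_mul_e_mul_e_mul_e _ (Fin.castSucc_lt_last j).ne, mul_assoc,
        e_mul_e_mul_e_mul_e _ (Fin.castSucc_lt_last i).ne,
        e_mul_e ((Fin.castSucc_injective n).ne hij), mul_assoc])

@[simp] theorem shift_neg (n : ℕ) : shift n (neg n) = neg (n + 1) := lift_neg ..

@[simp] theorem shift_e (i : Fin n) : shift n (e i) = e i.castSucc * e (Fin.last n) := lift_e ..

theorem shift_mem_evenWord (w : CliffordWord n) : shift n w ∈ evenWord (n + 1) := by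
  let s : Multiplicative (Fin (n + 1) → ZMod 2) →* Multiplicative (ZMod 2) :=
    MonoidHom.mk' (fun v => Multiplicative.ofAdd (∑ i, v.toAdd i)) fun v v' => by
      rw [toAdd_mul, ← ofAdd_add, ← Finset.sum_add_distrib]; rfl
  have h : (s.comp ((toVec (n + 1)).comp (shift n))) = 1 := by
    refine hom_ext (by simp) fun i => ?_
    simp only [MonoidHom.comp_apply, shift_e, map_mul, toVec_e]
    simp only [s, MonoidHom.mk'_apply, toAdd_ofAdd, Finset.sum_pi_single', Finset.mem_univ, if_true]
    rfl
  exact DFunLike.congr_fun h w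

theorem toVec_shift_castSucc (w : CliffordWord n) (i : Fin n) :
    (toVec (n + 1) (shift n w)).toAdd i.castSucc = (toVec n w).toAdd i := by
  let s : Multiplicative (Fin (n + 1) → ZMod 2) →* Multiplicative (Fin n → ZMod 2) :=
    MonoidHom.mk' (fun v => Multiplicative.ofAdd fun i => v.toAdd i.castSucc) fun v v' => rfl
  have h : (s.comp ((toVec (n + 1)).comp (shift n))) = toVec n := by
    refine hom_ext (by simp) fun i => ?_
    apply Multiplicative.toAdd.injective
    funext j
    simp [s, Pi.single_apply]
  exact congrFun (congrArg Multiplicative.toAdd (DFunLike.congr_fun h w)) i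

end CliffordWord

/-- Parity determines the last coordinate from the others. -/
theorem evenVec_ext {n : ℕ} {v w : Multiplicative (Fin (n + 1) → ZMod 2)} (hv : v ∈ evenVec (n + 1))
    (hw : w ∈ evenVec (n + 1)) (h : ∀ i : Fin n, v.toAdd i.castSucc = w.toAdd i.castSucc) :
    v = w := by
  apply Multiplicative.toAdd.injective
  funext i
  induction i using Fin.lastCases with
  | cast i => exact h i
  | last =>
    have hv' : ∑ i, v.toAdd i = 0 := hv
    have hw' : ∑ i, w.toAdd i = 0 := hw
    rw [Fin.sum_univ_castSucc] at hv' hw'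
    simp only [h] at hv'
    exact add_left_cancel (hv'.trans hw'.symm)

-- A word with the prescribed first $n$ coordinates hits the target up to sign, and `shift` sends
-- $-1$ to $-1$.
open CliffordWord in
theorem shift_surjective (n : ℕ) {x : CliffordWord (n + 1)} (hx : x ∈ evenWord (n + 1)) :
    ∃ w, shift n w = x := by
  obtain ⟨w, hw⟩ := toVec_surjective n
    (Multiplicative.ofAdd fun i => (toVec (n + 1) x).toAdd i.castSucc)
  have h : toVec (n + 1) (shift n w) = toVec (n + 1) x :=
    evenVec_ext (shift_mem_evenWord w) hx fun i => by rw [toVec_shift_castSucc, hw]; rfl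
  rcases eq_or_eq_neg_mul_of_toVec_eq h with h | h
  · exact ⟨w, h⟩
  · exact ⟨neg n * w, by rw [map_mul, shift_neg, h, ← mul_assoc, neg_sq, one_mul]⟩

open CliffordWord in
theorem evenWordToVec_surjective (n : ℕ) : Function.Surjective (evenWordToVec n) := by
  intro v
  obtain ⟨w, hw⟩ := toVec_surjective n v.1
  exact ⟨⟨w, by change toVec n w ∈ evenVec n; rw [hw]; exact v.2⟩, Subtype.ext hw⟩

end Hyperoctahedral

namespace Hyperoctahedral

open CliffordAlgebra

/-! ### The Clifford algebra and unit vectors -/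

theorem cliffordForm_apply {n : ℕ} (v : Fin n → ℝ) : cliffordForm n v = -∑ i, v i * v i := by
  simp [cliffordForm, QuadraticMap.weightedSumSquares_apply, Finset.sum_neg_distrib]

theorem cliffordBasis_mul_self {n : ℕ} (i : Fin n) :
    cliffordBasis i * cliffordBasis i = -1 := by
  rw [cliffordBasis, ι_sq_scalar, cliffordForm_apply]
  simp [Pi.single_apply]

theorem cliffordBasis_mul_comm {n : ℕ} {i j : Fin n} (hij : i ≠ j) :
    cliffordBasis i * cliffordBasis j = -(cliffordBasis j * cliffordBasis i) := by
  rw [eq_neg_iff_add_eq_zero, cliffordBasis, cliffordBasis, ι_mul_ι_add_swap,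
    QuadraticMap.polar, cliffordForm_apply, cliffordForm_apply, cliffordForm_apply]
  simp [Pi.single_apply, mul_add, Finset.sum_add_distrib, hij, hij.symm]

theorem ι_eq_sum_cliffordBasis {n : ℕ} (v : Fin n → ℝ) :
    ι (cliffordForm n) v = ∑ i, v i • cliffordBasis i := by
  conv_lhs => rw [pi_eq_sum_univ' v]
  rw [map_sum]
  refine Finset.sum_congr rfl fun i _ => ?_
  rw [map_smul, cliffordBasis]

/-- The unit vector `(e_i - e_j) / √2` in the Clifford algebra. -/
noncomputable def rootVector {n : ℕ} (i j : Fin n) : CliffordAlgebra (cliffordForm n) :=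
  (√2)⁻¹ • (cliffordBasis i - cliffordBasis j)

theorem rootVector_eq_ι {n : ℕ} (i j : Fin n) : rootVector i j =
    ι (cliffordForm n) ((√2)⁻¹ • (Pi.single i 1 - Pi.single j 1)) := by
  rw [map_smul, map_sub]; rfl

theorem rootVector_mul_self {n : ℕ} {i j : Fin n} (hij : i ≠ j) :
    rootVector i j * rootVector i j = -1 := by
  rw [rootVector, smul_mul_smul_comm, sub_mul, mul_sub, mul_sub, cliffordBasis_mul_self,
    cliffordBasis_mul_self, cliffordBasis_mul_comm hij, ← mul_inv,
    Real.mul_self_sqrt (by norm_num)]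
  rw [show (-1 - -(cliffordBasis j * cliffordBasis i) - (cliffordBasis j * cliffordBasis i - -1) :
    CliffordAlgebra (cliffordForm n)) = (-2 : ℝ) • 1 by rw [neg_smul, two_smul]; abel, smul_smul]
  norm_num

/-- Conjugation by a unit vector is minus the reflection in its orthogonal hyperplane, and for
$e_i-e_j$ this reflection exchanges the two basis vectors. The sign disappears in products of two
root vectors. -/
theorem rootVector_mul_cliffordBasis {n : ℕ} {i j : Fin n} (hij : i ≠ j) (k : Fin n) :
    rootVector i j * cliffordBasis k =
      -(cliffordBasis (Equiv.swap i j k) * rootVector i j) := by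
  rw [rootVector, smul_mul_assoc, mul_smul_comm, ← smul_neg]
  congr 1
  by_cases hki : k = i
  · subst hki
    rw [Equiv.swap_apply_left, sub_mul, mul_sub, cliffordBasis_mul_self, cliffordBasis_mul_self]
    abel
  by_cases hkj : k = j
  · subst hkj
    rw [Equiv.swap_apply_right, sub_mul, mul_sub, cliffordBasis_mul_self, cliffordBasis_mul_self]
    abel
  rw [Equiv.swap_apply_of_ne_of_ne hki hkj, sub_mul, mul_sub,
    cliffordBasis_mul_comm (Ne.symm hki), cliffordBasis_mul_comm (Ne.symm hkj)]
  abel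

/-- Orthogonal vectors anticommute. -/
theorem rootVector_mul_rootVector {n : ℕ} {i j k l : Fin n} (hij : i ≠ j) (hik : i ≠ k)
    (hil : i ≠ l) (hjk : j ≠ k) (hjl : j ≠ l) :
    rootVector i j * rootVector k l = -(rootVector k l * rootVector i j) := by
  conv_lhs => rw [rootVector.eq_def k l]
  conv_rhs => rw [rootVector.eq_def k l]
  rw [smul_mul_assoc, mul_smul_comm, ← smul_neg, mul_sub, sub_mul,
    rootVector_mul_cliffordBasis hij, rootVector_mul_cliffordBasis hij,
    Equiv.swap_apply_of_ne_of_ne hik.symm hjk.symm, Equiv.swap_apply_of_ne_of_ne hil.symm hjl.symm]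
  congr 1
  abel

theorem star_rootVector {n : ℕ} (i j : Fin n) : star (rootVector i j) = -rootVector i j := by
  rw [rootVector_eq_ι, star_ι]

theorem rootVector_mem_pinGroup {n : ℕ} {i j : Fin n} (hij : i ≠ j) :
    rootVector i j ∈ pinGroup (cliffordForm n) := by
  have h := rootVector_mul_self hij
  refine pinGroup.mem_iff.mpr ⟨?_, ?_⟩
  · refine ⟨⟨rootVector i j, -rootVector i j, by rw [mul_neg, h, neg_neg],
      by rw [neg_mul, h, neg_neg]⟩, Subgroup.subset_closure ?_, rfl⟩
    exact ⟨_, (rootVector_eq_ι i j).symm⟩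
  · rw [Unitary.mem_iff, star_rootVector, neg_mul, mul_neg, h, neg_neg]
    exact ⟨rfl, rfl⟩

/-- The element of the spin group that induces the product of two transpositions. -/
noncomputable def spinSwapSwap {n : ℕ} {i j k l : Fin n} (hij : i ≠ j) (hkl : k ≠ l) :
    spinGroup (cliffordForm n) :=
  ⟨rootVector i j * rootVector k l, spinGroup.mem_iff.mpr
    ⟨mul_mem (rootVector_mem_pinGroup hij) (rootVector_mem_pinGroup hkl), by
      rw [rootVector_eq_ι, rootVector_eq_ι]
      exact ι_mul_ι_mem_evenOdd_zero _ _ _⟩⟩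

/-- The lift to the spin extension of the product of two transpositions. -/
noncomputable def spinAltSwapSwap {n : ℕ} {i j k l : Fin n} (hij : i ≠ j) (hkl : k ≠ l) :
    SpinAlternating n :=
  ⟨(spinSwapSwap hij hkl, ⟨Equiv.swap i j * Equiv.swap k l, by
      rw [Equiv.Perm.mem_alternatingGroup, map_mul, Equiv.Perm.sign_swap hij,
        Equiv.Perm.sign_swap hkl]
      rfl⟩), fun m => by
    change rootVector i j * rootVector k l * cliffordBasis m =
      cliffordBasis (Equiv.swap i j (Equiv.swap k l m)) * (rootVector i j * rootVector k l)
    rw [mul_assoc, rootVector_mul_cliffordBasis hkl, mul_neg, ← mul_assoc,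
      rootVector_mul_cliffordBasis hij, neg_mul, neg_neg, mul_assoc]⟩

/-- Three-cycles generate the alternating group, and each is a product of two transpositions, for
which root vectors supply a lift. -/
theorem spinToAlt_surjective (n : ℕ) : Function.Surjective (spinToAlt n) := by
  rw [← MonoidHom.range_eq_top]
  let M := (spinToAlt n).range.map (alternatingGroup (Fin n)).subtype
  have hle : alternatingGroup (Fin n) ≤ M := by
    rw [← Equiv.Perm.closure_three_cycles_eq_alternating, Subgroup.closure_le]
    intro g hg
    obtain ⟨x, hx⟩ := hg.isCycle.nonempty_support
    have hnd := hg.nodup_iff_mem_support.mpr hx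
    simp only [List.nodup_cons, List.mem_cons, List.not_mem_nil, or_false, not_or] at hnd
    rw [hg.eq_swap_mul_swap_iff_mem_support.mpr hx]
    exact ⟨_, ⟨spinAltSwapSwap hnd.1.1 hnd.2.1, rfl⟩, rfl⟩
  rw [eq_top_iff]
  intro g _
  obtain ⟨g', hg', h⟩ := hle g.2
  rwa [← Subtype.ext h]

theorem SpinAlternating.ext' {n : ℕ} {x y : SpinAlternating n}
    (h1 : (x.1.1 : CliffordAlgebra (cliffordForm n)) = y.1.1)
    (h2 : spinToAlt n x = spinToAlt n y) : x = y :=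
  Subtype.ext (Prod.ext (Subtype.ext h1) h2)

/-- The element `-1` of the spin extension. -/
noncomputable def spinNeg {n : ℕ} {i j : Fin n} (hij : i ≠ j) : SpinAlternating n :=
  spinAltSwapSwap hij hij

theorem coe_spinNeg {n : ℕ} {i j : Fin n} (hij : i ≠ j) :
    ((spinNeg hij).1.1 : CliffordAlgebra (cliffordForm n)) = -1 :=
  rootVector_mul_self hij

theorem spinToAlt_spinNeg {n : ℕ} {i j : Fin n} (hij : i ≠ j) : spinToAlt n (spinNeg hij) = 1 :=
  Subtype.ext (Equiv.swap_mul_self i j)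

theorem neg_one_ne_one_cliffordAlgebra (n : ℕ) :
    (-1 : CliffordAlgebra (cliffordForm n)) ≠ 1 := by
  intro h
  have h1 : algebraMap ℝ (CliffordAlgebra (cliffordForm n)) (-1) = algebraMap ℝ _ 1 := by
    rw [map_neg, map_one, h]
  have := (algebraMap ℝ (CliffordAlgebra (cliffordForm n))).injective h1
  norm_num at this

theorem spinNeg_ne_one {n : ℕ} {i j : Fin n} (hij : i ≠ j) : spinNeg hij ≠ 1 := by
  intro h
  apply neg_one_ne_one_cliffordAlgebra n
  rw [← coe_spinNeg hij, h]
  rfl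

/-- For orthogonal root vectors $uvuv=-u^2v^2=-1$. This is the property of double transpositions
that singles out the spin cover. -/
theorem spinAltSwapSwap_sq {n : ℕ} {i j k l : Fin n} (hij : i ≠ j) (hik : i ≠ k)
    (hil : i ≠ l) (hjk : j ≠ k) (hjl : j ≠ l) (hkl : k ≠ l) :
    spinAltSwapSwap hij hkl ^ 2 = spinNeg hij := by
  rw [pow_two]
  refine SpinAlternating.ext' ?_ ?_
  · rw [coe_spinNeg]
    change rootVector i j * rootVector k l * (rootVector i j * rootVector k l) = -1
    rw [mul_assoc, ← mul_assoc (rootVector k l), rootVector_mul_rootVector hkl hik.symm hjk.symm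
      hil.symm hjl.symm, neg_mul, mul_neg, mul_assoc (rootVector i j), rootVector_mul_self hkl,
      mul_neg, mul_neg, neg_neg, mul_one, rootVector_mul_self hij]
  · rw [spinToAlt_spinNeg]
    exact Subtype.ext (swap_mul_swap_mul_self hik hij hil hjk.symm hkl hjl)

/-- For mutually orthogonal root vectors $(uv)(uw)=vw$ and $(uw)(uv)=wv=-vw$. So $-1$ is a
commutator in $\widetilde A_n$ once six indices are available. -/
theorem spinAltSwapSwap_mul_comm {n : ℕ} {i j k l a b : Fin n} (hij : i ≠ j) (hkl : k ≠ l)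
    (hab : a ≠ b) (hik : i ≠ k) (hil : i ≠ l) (hjk : j ≠ k) (hjl : j ≠ l) (hia : i ≠ a)
    (hib : i ≠ b) (hja : j ≠ a) (hjb : j ≠ b) (hka : k ≠ a) (hkb : k ≠ b) (hla : l ≠ a)
    (hlb : l ≠ b) :
    spinAltSwapSwap hij hkl * spinAltSwapSwap hij hab =
      spinNeg hij * (spinAltSwapSwap hij hab * spinAltSwapSwap hij hkl) := by
  have hmul : ∀ {k l a b : Fin n}, i ≠ k → i ≠ l → j ≠ k → j ≠ l →
      rootVector i j * rootVector k l * (rootVector i j * rootVector a b) =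
        rootVector k l * rootVector a b := by
    intro k l a b hik hil hjk hjl
    rw [mul_assoc, ← mul_assoc (rootVector k l), ← neg_neg (rootVector k l * rootVector i j),
      ← rootVector_mul_rootVector hij hik hil hjk hjl, neg_mul, mul_neg, ← mul_assoc,
      ← mul_assoc, rootVector_mul_self hij, neg_one_mul, neg_mul, neg_neg]
  refine SpinAlternating.ext' ?_ ?_
  · change rootVector i j * rootVector k l * (rootVector i j * rootVector a b) =
      (spinNeg hij).1.1 * (rootVector i j * rootVector a b * (rootVector i j * rootVector k l))
    rw [coe_spinNeg, hmul hik hil hjk hjl, hmul hia hib hja hjb,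
      rootVector_mul_rootVector hkl hka hkb hla hlb, neg_one_mul]
  · rw [map_mul, map_mul, map_mul, spinToAlt_spinNeg, one_mul]
    apply Subtype.ext
    change Equiv.swap i j * Equiv.swap k l * (Equiv.swap i j * Equiv.swap a b) =
      Equiv.swap i j * Equiv.swap a b * (Equiv.swap i j * Equiv.swap k l)
    have h1 := (Equiv.Perm.disjoint_swap_swap (x := i) (y := j) (z := k) (t := l)
      (by simp [*])).commute
    have h2 := (Equiv.Perm.disjoint_swap_swap (x := i) (y := j) (z := a) (t := b)
      (by simp [*])).commute
    have h3 := (Equiv.Perm.disjoint_swap_swap (x := k) (y := l) (z := a) (t := b)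
      (by simp [*])).commute
    exact Commute.mul_left ((Commute.refl _).mul_right h2) (h1.symm.mul_right h3)

/-! ### The kernel of the spin extension -/

/-- The homomorphism from the group of Clifford words to the units of the Clifford algebra. -/
noncomputable def wordUnit (n : ℕ) : CliffordWord n →* (CliffordAlgebra (cliffordForm n))ˣ :=
  CliffordWord.lift (-1)
    (fun i => ⟨cliffordBasis i, -cliffordBasis i, by rw [mul_neg, cliffordBasis_mul_self, neg_neg],
      by rw [neg_mul, cliffordBasis_mul_self, neg_neg]⟩)
    (by simp) (by simp) (fun i => Units.ext (cliffordBasis_mul_self i))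
    fun i j hij => Units.ext <| by
      change cliffordBasis i * cliffordBasis j = -1 * cliffordBasis j * cliffordBasis i
      rw [cliffordBasis_mul_comm hij, neg_one_mul, neg_mul]

theorem wordUnit_neg (n : ℕ) : wordUnit n (CliffordWord.neg n) = -1 := CliffordWord.lift_neg ..

theorem coe_wordUnit_e {n : ℕ} (i : Fin n) :
    (wordUnit n (CliffordWord.e i) : CliffordAlgebra (cliffordForm n)) = cliffordBasis i :=
  congrArg Units.val (CliffordWord.lift_e ..)

/-- The presentation alone does not show that $-1$ survives; its image in the Clifford algebra does.
-/
theorem CliffordWord.neg_ne_one (n : ℕ) : CliffordWord.neg n ≠ 1 := by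
  intro h
  apply neg_one_ne_one_cliffordAlgebra n
  have := congrArg Units.val (wordUnit_neg n)
  rw [h, map_one] at this
  simpa using this.symm

/-- The sign with which an even word commutes with `e_i` is given by its `i`-th coordinate. -/
theorem cliffordBasis_mul_wordUnit {n : ℕ} (i : Fin n) {w : CliffordWord n} (hw : w ∈ evenWord n) :
    cliffordBasis i * (wordUnit n w : CliffordAlgebra (cliffordForm n)) * cliffordBasis i =
      if (CliffordWord.toVec n w).toAdd i = 0 then -(wordUnit n w : CliffordAlgebra _)
      else wordUnit n w := by
  -- Conjugation by $e_i$ changes the sign of $e_j$ exactly for $j\ne i$, giving the exponent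
  -- $\sum_j v_j+v_i$; on even words only $v_i$ remains. The further sign in the statement comes
  -- from $e_i^{-1}=-e_i$.
  let θ : Multiplicative (Fin n → ZMod 2) →* ℤˣ := MonoidHom.mk'
    (fun v => (-1 : ℤˣ) ^ (∑ j, v.toAdd j + v.toAdd i)) fun v v' => by
      rw [← uzpow_add]
      congr 1
      simp only [toAdd_mul, Pi.add_apply, Finset.sum_add_distrib]
      abel
  let ψ : ℤˣ →* (CliffordAlgebra (cliffordForm n))ˣ :=
    Units.map (Int.castRingHom (CliffordAlgebra (cliffordForm n)) : ℤ →* _)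
  let L : CliffordWord n →* (CliffordAlgebra (cliffordForm n))ˣ :=
    MonoidHom.mk' (fun w => ψ (θ (CliffordWord.toVec n w)) * wordUnit n w) fun a b => by
      have : ∀ (z : ℤˣ) (x : (CliffordAlgebra (cliffordForm n))ˣ), ψ z * x = x * ψ z :=
        fun z x => Units.ext (Int.cast_commute _ _)
      rw [map_mul, map_mul, map_mul, map_mul, mul_assoc, mul_assoc, ← mul_assoc (wordUnit n a), ← this]
      simp only [mul_assoc]
  have hψ : ψ (-1) = -1 := Units.ext (by simp [ψ])
  have hL : (MulAut.conj (wordUnit n (CliffordWord.e i))).toMonoidHom.comp (wordUnit n) = L := by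
    refine CliffordWord.hom_ext ?_ fun j => ?_
    · simp [L, θ, wordUnit_neg]
    · have h1 : θ (CliffordWord.toVec n (CliffordWord.e j)) = if i = j then 1 else -1 := by
        simp only [CliffordWord.toVec_e, θ, MonoidHom.mk'_apply, toAdd_ofAdd,
          Finset.sum_pi_single', Finset.mem_univ, if_true]
        split_ifs with hij
        · rw [hij, Pi.single_eq_same]; rfl
        · rw [Pi.single_eq_of_ne hij, add_zero, uzpow_one]
      change wordUnit n (CliffordWord.e i) * wordUnit n (CliffordWord.e j) *
        (wordUnit n (CliffordWord.e i))⁻¹ = ψ (θ (CliffordWord.toVec n (CliffordWord.e j))) *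
          wordUnit n (CliffordWord.e j)
      rw [h1, mul_inv_eq_iff_eq_mul]
      split_ifs with hij
      · rw [hij, map_one, one_mul]
      · rw [hψ]
        apply Units.ext
        rw [Units.val_mul, Units.val_mul, Units.val_mul, coe_wordUnit_e, coe_wordUnit_e,
          cliffordBasis_mul_comm hij]
        simp
  have h1 := DFunLike.congr_fun hL w
  have h2 : wordUnit n (CliffordWord.e i) * wordUnit n w * (wordUnit n (CliffordWord.e i))⁻¹ =
    ψ (θ (CliffordWord.toVec n w)) * wordUnit n w := h1
  rw [mul_inv_eq_iff_eq_mul] at h2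
  have h3 := congrArg Units.val h2
  rw [Units.val_mul, Units.val_mul, Units.val_mul, coe_wordUnit_e] at h3
  rw [h3, mul_assoc, cliffordBasis_mul_self]
  have hw' : ∑ j, (CliffordWord.toVec n w).toAdd j = 0 := hw
  have h4 : θ (CliffordWord.toVec n w) = (-1 : ℤˣ) ^ ((CliffordWord.toVec n w).toAdd i) := by
    simp only [θ, MonoidHom.mk'_apply, hw', zero_add]
  rw [h4]
  split_ifs with h0
  · rw [h0, uzpow_zero, map_one]; simp
  · have h5 : (CliffordWord.toVec n w).toAdd i = 1 := by
      revert h0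
      generalize (CliffordWord.toVec n w).toAdd i = x
      revert x; decide
    rw [h5, uzpow_one, hψ]; simp

/-- An even element of the Clifford algebra that commutes with all vectors is a scalar. -/
theorem exists_algebraMap_eq_of_mem_even {n : ℕ} {x : CliffordAlgebra (cliffordForm n)}
    (hx : x ∈ even (cliffordForm n)) (hc : ∀ i, x * cliffordBasis i = cliffordBasis i * x) :
    ∃ r : ℝ, algebraMap ℝ _ r = x := by
  -- Spans of even words that avoid the symbols in $s$. Working with spans avoids any need for
  -- linear independence of the words.
  let W : Finset (Fin n) → Submodule ℝ (CliffordAlgebra (cliffordForm n)) := fun s =>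
    Submodule.span ℝ {y | ∃ w ∈ evenWord n, (∀ i ∈ s, (CliffordWord.toVec n w).toAdd i = 0) ∧
      (wordUnit n w : CliffordAlgebra (cliffordForm n)) = y}
  have hbW : ∀ i j, ∀ y ∈ W ∅, cliffordBasis i * cliffordBasis j * y ∈ W ∅ := by
    intro i j y hy
    induction hy using Submodule.span_induction with
    | mem y hy =>
      obtain ⟨w, hw, -, rfl⟩ := hy
      refine Submodule.subset_span ⟨CliffordWord.e i * CliffordWord.e j * w, mul_mem ?_ hw,
        by simp, by rw [map_mul, map_mul, Units.val_mul, Units.val_mul, coe_wordUnit_e,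
          coe_wordUnit_e]⟩
      change ∑ k, (CliffordWord.toVec n (CliffordWord.e i * CliffordWord.e j)).toAdd k = 0
      simp only [map_mul, CliffordWord.toVec_e, toAdd_mul, toAdd_ofAdd, Pi.add_apply,
        Finset.sum_add_distrib, Finset.sum_pi_single', Finset.mem_univ, if_true]
      rfl
    | zero => rw [mul_zero]; exact zero_mem _
    | add a b _ _ ha hb => rw [mul_add]; exact add_mem ha hb
    | smul r a _ ha => rw [mul_smul_comm]; exact Submodule.smul_mem _ _ ha
  have h0 : x ∈ W ∅ := by
    have hx' : x ∈ evenOdd (cliffordForm n) 0 := hx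
    clear hx hc
    induction x, hx' using even_induction with
    | algebraMap r =>
      rw [Algebra.algebraMap_eq_smul_one]
      exact Submodule.smul_mem _ _ (Submodule.subset_span ⟨1, one_mem _, by simp, by simp⟩)
    | add x y hx hy hx' hy' => exact add_mem hx' hy'
    | ι_mul_ι_mul m₁ m₂ x hx ih =>
      rw [ι_eq_sum_cliffordBasis, ι_eq_sum_cliffordBasis, Finset.sum_mul_sum, Finset.sum_mul]
      refine Submodule.sum_mem _ fun i _ => ?_
      rw [Finset.sum_mul]
      refine Submodule.sum_mem _ fun j _ => ?_
      rw [smul_mul_smul_comm, smul_mul_assoc]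
      exact Submodule.smul_mem _ _ (hbW i j x ih)
  -- This operator doubles words without $e_i$ and kills words containing it. On an element
  -- commuting with $e_i$ it is multiplication by $2$, so $x$ stays in the span as symbols are
  -- removed.
  have hstep : ∀ s i, ∀ y ∈ W s, y - cliffordBasis i * y * cliffordBasis i ∈ W (insert i s) := by
    intro s i y hy
    induction hy using Submodule.span_induction with
    | mem y hy =>
      obtain ⟨w, hw, hs, rfl⟩ := hy
      rw [cliffordBasis_mul_wordUnit i hw]
      split_ifs with h
      · rw [sub_neg_eq_add]
        have : (wordUnit n w : CliffordAlgebra (cliffordForm n)) ∈ W (insert i s) :=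
          Submodule.subset_span ⟨w, hw, fun j hj => by
            rcases Finset.mem_insert.mp hj with rfl | hj
            · exact h
            · exact hs j hj, rfl⟩
        exact add_mem this this
      · rw [sub_self]; exact zero_mem _
    | zero => simp
    | add a b _ _ ha hb =>
      rw [mul_add, add_mul, add_sub_add_comm]; exact add_mem ha hb
    | smul r a _ ha =>
      rw [mul_smul_comm, smul_mul_assoc, ← smul_sub]; exact Submodule.smul_mem _ _ ha
  have hall : ∀ s, x ∈ W s := by
    intro s
    induction s using Finset.induction_on with
    | empty => exact h0
    | insert i s _ ih =>
      have h1 := hstep s i x ih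
      rw [← hc, mul_assoc, cliffordBasis_mul_self, mul_neg, mul_one, sub_neg_eq_add,
        ← two_smul ℝ x] at h1
      have h2 := Submodule.smul_mem _ (2⁻¹ : ℝ) h1
      rwa [smul_smul, inv_mul_cancel₀ two_ne_zero, one_smul] at h2
  have hle : W Finset.univ ≤ Submodule.span ℝ {1} := by
    rw [Submodule.span_le]
    rintro _ ⟨w, -, hw, rfl⟩
    have h1 : CliffordWord.toVec n w = 1 :=
      Multiplicative.toAdd.injective (funext fun i => hw i (Finset.mem_univ i))
    rcases CliffordWord.eq_one_or_eq_neg_of_toVec_eq_one h1 with rfl | rfl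
    · exact Submodule.subset_span (by simp)
    · rw [wordUnit_neg, Units.val_neg, Units.val_one]
      exact neg_mem (Submodule.subset_span rfl)
  obtain ⟨r, hr⟩ := Submodule.mem_span_singleton.mp (hle (hall _))
  exact ⟨r, by rw [Algebra.algebraMap_eq_smul_one, hr]⟩

/-- A spin element over the identity commutes with every $e_i$ and is even, hence a real scalar $r$;
unitarity gives $r^2=1$. -/
theorem spinToAlt_eq_one_iff {n : ℕ} {i j : Fin n} (hij : i ≠ j) (x : SpinAlternating n) :
    spinToAlt n x = 1 ↔ x = 1 ∨ x = spinNeg hij := by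
  constructor
  · intro hx
    have hx2 : x.1.2 = 1 := hx
    have hmem := x.1.1.2
    obtain ⟨r, hr⟩ := exists_algebraMap_eq_of_mem_even (spinGroup.mem_even hmem) fun i => by
      have := x.2 i
      rw [hx2] at this
      exact this
    have h1 := pinGroup.star_mul_self_of_mem (spinGroup.mem_pin hmem)
    rw [← hr, star_algebraMap, ← map_mul] at h1
    have h2 : r * r = 1 := (algebraMap ℝ (CliffordAlgebra (cliffordForm n))).injective
      (h1.trans (map_one _).symm)
    rcases mul_self_eq_one_iff.mp h2 with rfl | rfl
    · left
      exact SpinAlternating.ext' (hr.symm.trans (map_one _)) hx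
    · right
      refine SpinAlternating.ext' ?_ (hx.trans (spinToAlt_spinNeg hij).symm)
      rw [coe_spinNeg, ← hr, map_neg, map_one]
  · rintro (rfl | rfl)
    · exact map_one _
    · exact spinToAlt_spinNeg hij

end Hyperoctahedral

namespace Hyperoctahedral

open CliffordWord

/-! ### Pairs of basis vectors -/

/-- The even vector `e_i + e_j`. -/
def pairVec {n : ℕ} (i j : Fin n) : evenVec n :=
  ⟨Multiplicative.ofAdd (Pi.single i 1 + Pi.single j 1), by
    change ∑ k, (Pi.single i 1 + Pi.single j 1 : Fin n → ZMod 2) k = 0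
    simp only [Pi.add_apply, Finset.sum_add_distrib, Finset.sum_pi_single', Finset.mem_univ,
      if_true]
    rfl⟩

theorem altOnEvenVec_pairVec {n : ℕ} (a : alternatingGroup (Fin n)) (i j : Fin n) :
    altOnEvenVec n a (pairVec i j) =
      pairVec ((a : Equiv.Perm (Fin n)) i) ((a : Equiv.Perm (Fin n)) j) := by
  apply Subtype.ext
  apply Multiplicative.toAdd.injective
  funext k
  change (Pi.single i 1 + Pi.single j 1 : Fin n → ZMod 2) ((a : Equiv.Perm (Fin n))⁻¹ k) =
    (Pi.single _ 1 + Pi.single _ 1 : Fin n → ZMod 2) k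
  simp [Pi.single_apply, Equiv.symm_apply_eq]

theorem pairVec_mul_pairVec {n : ℕ} (i j k : Fin n) :
    pairVec i j * pairVec j k = pairVec i k := by
  apply Subtype.ext
  apply Multiplicative.toAdd.injective
  have h : (Pi.single j 1 + Pi.single j 1 : Fin n → ZMod 2) = 0 := by
    rw [← Pi.single_add]; exact Pi.single_zero j
  change (Pi.single i 1 + Pi.single j 1 + (Pi.single j 1 + Pi.single k 1) : Fin n → ZMod 2) =
    Pi.single i 1 + Pi.single k 1
  rw [add_assoc, ← add_assoc (Pi.single j 1), h, zero_add]

theorem pairVec_comm {n : ℕ} (i j : Fin n) : pairVec i j = pairVec j i :=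
  Subtype.ext (congrArg Multiplicative.ofAdd (add_comm _ _))

theorem pairVec_mul_self {n : ℕ} (i j : Fin n) : pairVec i j * pairVec i j = 1 := by
  conv_lhs => arg 2; rw [pairVec_comm]
  rw [pairVec_mul_pairVec]
  apply Subtype.ext
  apply Multiplicative.toAdd.injective
  change (Pi.single i 1 + Pi.single i 1 : Fin n → ZMod 2) = 0
  rw [← Pi.single_add]; exact Pi.single_zero i

/-- The even word `e_i e_j`. -/
def pairWord {n : ℕ} (i j : Fin n) : evenWord n :=
  ⟨e i * e j, by
    change toVec n (e i * e j) ∈ evenVec n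
    rw [map_mul, toVec_e, toVec_e]
    exact (pairVec i j).2⟩

/-- The even word `-1`. -/
def negWord (n : ℕ) : evenWord n :=
  ⟨neg n, by
    change toVec n (neg n) ∈ evenVec n
    rw [toVec_neg]
    exact one_mem _⟩

theorem evenWordToVec_pairWord {n : ℕ} (i j : Fin n) :
    evenWordToVec n (pairWord i j) = pairVec i j := by
  apply Subtype.ext
  change toVec n (e i * e j) = _
  rw [map_mul, toVec_e, toVec_e]
  rfl

theorem evenWordToVec_negWord (n : ℕ) : evenWordToVec n (negWord n) = 1 :=
  Subtype.ext (toVec_neg n)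

theorem evenWordToVec_eq_one_iff {n : ℕ} (w : evenWord n) :
    evenWordToVec n w = 1 ↔ w = 1 ∨ w = negWord n := by
  constructor
  · intro h
    rcases eq_one_or_eq_neg_of_toVec_eq_one (congrArg Subtype.val h) with h | h
    · exact Or.inl (Subtype.ext h)
    · exact Or.inr (Subtype.ext h)
  · rintro (rfl | rfl)
    · exact map_one _
    · exact evenWordToVec_negWord n

theorem altOnEvenWord_pairWord {n : ℕ} (a : alternatingGroup (Fin n)) (i j : Fin n) :
    altOnEvenWord n a (pairWord i j) =
      pairWord ((a : Equiv.Perm (Fin n)) i) ((a : Equiv.Perm (Fin n)) j) := by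
  apply Subtype.ext
  change permHom (a : Equiv.Perm (Fin n)) (e i * e j) = _
  rw [map_mul, permHom_e, permHom_e]
  rfl

theorem altOnEvenWord_negWord {n : ℕ} (a : alternatingGroup (Fin n)) :
    altOnEvenWord n a (negWord n) = negWord n :=
  Subtype.ext (permHom_neg (a : Equiv.Perm (Fin n)))

theorem pairWord_mul_pairWord {n : ℕ} (i : Fin n) {j l : Fin n} (hjl : j ≠ l) :
    pairWord i l * pairWord j l = pairWord i j :=
  Subtype.ext (e_mul_e_mul_e_mul_e i hjl)

theorem pairWord_swap {n : ℕ} {i j : Fin n} (hij : i ≠ j) :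
    pairWord i j = negWord n * pairWord j i :=
  Subtype.ext ((e_mul_e hij).trans (mul_assoc _ _ _))

theorem negWord_mem_center (n : ℕ) : negWord n ∈ Subgroup.center (evenWord n) :=
  Subgroup.mem_center_iff.mpr fun w =>
    Subtype.ext (Subgroup.mem_center_iff.mp (neg_mem_center n) w)

/-- The isomorphism from the group of Clifford words in `n` symbols to the group of even Clifford
words in `n + 1` symbols. -/
noncomputable def shiftEquiv (n : ℕ) : CliffordWord n ≃* evenWord (n + 1) :=
  MulEquiv.ofBijective ((shift n).codRestrict _ shift_mem_evenWord) <| by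
    constructor
    · rw [injective_iff_map_eq_one]
      intro w hw
      have hw : shift n w = 1 := congrArg Subtype.val hw
      have h1 : toVec n w = 1 := Multiplicative.toAdd.injective (funext fun i => by
        rw [← toVec_shift_castSucc, hw, map_one]; rfl)
      rcases eq_one_or_eq_neg_of_toVec_eq_one h1 with h | h
      · exact h
      · rw [h, shift_neg] at hw
        exact absurd hw (neg_ne_one _)
    · intro x
      obtain ⟨w, hw⟩ := shift_surjective n x.2
      exact ⟨w, Subtype.ext hw⟩

theorem shiftEquiv_neg (n : ℕ) : shiftEquiv n (neg n) = negWord (n + 1) :=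
  Subtype.ext (shift_neg n)

theorem shiftEquiv_e {n : ℕ} (i : Fin n) :
    shiftEquiv n (e i) = pairWord i.castSucc (Fin.last n) :=
  Subtype.ext (shift_e i)

/-- Through `shiftEquiv`, the even words are generated by $-1$ and the products $e_ie_n$. -/
theorem evenWord_hom_ext {n : ℕ} {G : Type*} [Group G] {f g : evenWord (n + 1) →* G}
    (h0 : f (negWord (n + 1)) = g (negWord (n + 1)))
    (h : ∀ i : Fin n, f (pairWord i.castSucc (Fin.last n)) =
      g (pairWord i.castSucc (Fin.last n))) : f = g := by
  have h1 : f.comp (shiftEquiv n).toMonoidHom = g.comp (shiftEquiv n).toMonoidHom :=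
    CliffordWord.hom_ext (by simpa [shiftEquiv_neg] using h0) fun i => by
      simpa [shiftEquiv_e] using h i
  ext w
  obtain ⟨x, rfl⟩ := (shiftEquiv n).surjective w
  exact DFunLike.congr_fun h1 x

/-! ### Perfectness -/

theorem exists_ne_ne {n : ℕ} (hn : 3 ≤ n) (i j : Fin n) : ∃ k, i ≠ k ∧ j ≠ k := by
  have h : ({i, j} : Finset (Fin n)).card < (Finset.univ : Finset (Fin n)).card := by
    rw [Finset.card_univ, Fintype.card_fin]
    exact lt_of_le_of_lt Finset.card_le_two (by omega)
  obtain ⟨k, -, hk⟩ := Finset.exists_mem_notMem_of_card_lt_card h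
  simp only [Finset.mem_insert, Finset.mem_singleton, not_or] at hk
  exact ⟨k, Ne.symm hk.1, Ne.symm hk.2⟩

theorem isPerfect_of_abelianization_of_eq_one {G : Type*} [Group G]
    (h : ∀ x : G, Abelianization.of x = 1) : Group.IsPerfect G :=
  ⟨by
    rw [eq_top_iff, ← Abelianization.ker_of]
    exact fun x _ => h x⟩

theorem isPerfect_alternatingGroup {n : ℕ} (hn : 5 ≤ n) :
    Group.IsPerfect (alternatingGroup (Fin n)) :=
  ⟨commutator_alternatingGroup_eq_top (by rwa [Nat.card_fin])⟩

/-- The group of evenly signed even permutations is perfect in degree at least `5`. -/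
theorem isPerfect_evenSignedPerm {n : ℕ} (hn : 5 ≤ n) : Group.IsPerfect (EvenSignedPerm n) := by
  refine isPerfect_of_abelianization_of_eq_one fun x => ?_
  let ab : EvenSignedPerm n →* Abelianization (EvenSignedPerm n) := Abelianization.of
  have hr : ∀ a, ab (SemidirectProduct.inr a) = 1 := fun a =>
    (isPerfect_alternatingGroup hn).hom_eq_one (ab.comp SemidirectProduct.inr) a
  have hact : ∀ a v, ab (SemidirectProduct.inl (altOnEvenVec n a v)) =
      ab (SemidirectProduct.inl v) := fun a v => by
    rw [SemidirectProduct.inl_aut, map_mul, map_mul, hr, hr, one_mul, mul_one]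
  have hpair : ∀ i j : Fin n, i ≠ j → ab (SemidirectProduct.inl (pairVec i j)) = 1 := by
    intro i j hij
    obtain ⟨k, hik, hjk⟩ : ∃ k, i ≠ k ∧ j ≠ k := exists_ne_ne (by omega) i j
    obtain ⟨a, h1, h2, -⟩ := exists_alternatingGroup_apply_triple hn hij hik hjk
      hjk hij.symm hik.symm
    obtain ⟨b, h3, h4, -⟩ := exists_alternatingGroup_apply_triple hn hij hik hjk
      hik hij hjk.symm
    have e1 := hact a (pairVec i j)
    have e2 := hact b (pairVec i j)
    rw [altOnEvenVec_pairVec, h1, h2] at e1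
    rw [altOnEvenVec_pairVec, h3, h4] at e2
    -- All three pairs are conjugate under $A_n$, so the relation reads $x\cdot x=x$.
    have e3 := congrArg (fun v => ab (SemidirectProduct.inl v)) (pairVec_mul_pairVec i j k)
    simp only [map_mul] at e3
    rw [e2, e1] at e3
    exact mul_eq_left.mp e3
  obtain ⟨m, rfl⟩ : ∃ m, n = m + 1 := ⟨n - 1, by omega⟩
  have hl : (ab.comp SemidirectProduct.inl).comp (evenWordToVec (m + 1)) = 1 :=
    evenWord_hom_ext (by simp [evenWordToVec_negWord]) fun i => by
      simpa [evenWordToVec_pairWord] using hpair _ _ (Fin.castSucc_lt_last i).ne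
  change ab x = 1
  rw [← SemidirectProduct.inl_left_mul_inr_right x, map_mul, hr, mul_one]
  obtain ⟨w, hw⟩ := evenWordToVec_surjective (m + 1) x.left
  rw [← hw]
  exact DFunLike.congr_fun hl w

/-! ### Lifts of even words and of the spin extension -/

/-- The injective pair with given distinct entries. -/
def pairEmb {α : Type*} {i j : α} (hij : i ≠ j) : Fin 2 ↪ α :=
  ⟨![i, j], by
    intro a b
    fin_cases a <;> fin_cases b <;> simp [hij, hij.symm]⟩

/-- In a central extension of the group of evenly signed even permutations, the vectors
`e_i + e_j` have lifts that satisfy the relations of the words `e_i e_j`. -/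
theorem exists_pairVec_lift {K : Type*} [Group K] {n : ℕ} (hn : 7 ≤ n)
    {p : K →* EvenSignedPerm n} (hp : IsCentralExtension p) :
    ∃ (S : Fin n → Fin n → K) (d : K), p d = 1 ∧ d * d = 1 ∧
      (∀ i j, i ≠ j → p (S i j) = SemidirectProduct.inl (pairVec i j)) ∧
      (∀ (y : K) (a : alternatingGroup (Fin n)) i j, i ≠ j → p y = SemidirectProduct.inr a →
        S ((a : Equiv.Perm (Fin n)) i) ((a : Equiv.Perm (Fin n)) j) = y * S i j * y⁻¹) ∧
      (∀ i j, i ≠ j → S j i = d * S i j) ∧ (∀ i j, i ≠ j → S i j * S i j = d) ∧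
      ∀ i j k, i ≠ j → i ≠ k → j ≠ k → S i j * S j k = d * S i k := by
  classical
  obtain ⟨F, hF, hconj⟩ := hp.exists_equivariant_lift (k := 2) (by omega) SemidirectProduct.inr
    (fun s => SemidirectProduct.inl (pairVec (s 0) (s 1))) <| by
      intro a s
      rw [← map_inv, ← SemidirectProduct.inl_aut, altOnEvenVec_pairVec]
      rfl
  let S₀ : Fin n → Fin n → K := fun i j => if h : i ≠ j then F (pairEmb h) else 1
  have hS₀p : ∀ i j, i ≠ j → p (S₀ i j) = SemidirectProduct.inl (pairVec i j) := by
    intro i j hij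
    simp only [S₀]
    rw [dif_pos hij, hF]
    rfl
  have hS₀c : ∀ (y : K) (a : alternatingGroup (Fin n)) i j, i ≠ j →
      p y = SemidirectProduct.inr a →
      S₀ ((a : Equiv.Perm (Fin n)) i) ((a : Equiv.Perm (Fin n)) j) = y * S₀ i j * y⁻¹ := by
    intro y a i j hij hy
    simp only [S₀]
    rw [dif_pos ((a : Equiv.Perm (Fin n)).injective.ne hij), dif_pos hij, ← hconj y a _ hy]
    congr 1
    ext l
    fin_cases l <;> rfl
  have hcen : ∀ z : K, p z = 1 → ∀ x, x * z = z * x := fun z hz x =>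
    Subgroup.mem_center_iff.mp (hp.ker_le_center hz) x
  let s : Fin 3 ↪ Fin n := Fin.castLEEmb (by omega)
  have hs : ∀ {a b : Fin 3}, a ≠ b → s a ≠ s b := fun h => s.injective.ne h
  have h01 : s 0 ≠ s 1 := hs (by decide)
  have h02 : s 0 ≠ s 2 := hs (by decide)
  have h12 : s 1 ≠ s 2 := hs (by decide)
  obtain ⟨c, hcp, hc⟩ : ∃ c, p c = 1 ∧ ∀ i j k, i ≠ j → i ≠ k → j ≠ k →
      S₀ i j * S₀ j k = c * S₀ i k := by
    have h1 : p (S₀ (s 0) (s 1) * S₀ (s 1) (s 2) * (S₀ (s 0) (s 2))⁻¹) = 1 := by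
      rw [map_mul, map_mul, map_inv, hS₀p _ _ h01, hS₀p _ _ h12, hS₀p _ _ h02, mul_inv_eq_one,
        ← map_mul, pairVec_mul_pairVec]
    refine ⟨_, h1, fun i j k hij hik hjk => ?_⟩
    obtain ⟨a, rfl, rfl, rfl⟩ := exists_alternatingGroup_apply_triple (by omega) h01 h02 h12
      hij hik hjk
    obtain ⟨y, hy⟩ := hp.surjective (SemidirectProduct.inr a)
    rw [hS₀c y a _ _ h01 hy, hS₀c y a _ _ h12 hy, hS₀c y a _ _ h02 hy]
    calc _ = y * (S₀ (s 0) (s 1) * S₀ (s 1) (s 2) * (S₀ (s 0) (s 2))⁻¹) * S₀ (s 0) (s 2) * y⁻¹ := by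
          group
      _ = _ := by rw [hcen _ h1 y]; group
  obtain ⟨d, hdp, hd⟩ : ∃ d, p d = 1 ∧ ∀ i j, i ≠ j → S₀ j i = d * S₀ i j := by
    have h1 : p (S₀ (s 1) (s 0) * (S₀ (s 0) (s 1))⁻¹) = 1 := by
      rw [map_mul, map_inv, hS₀p _ _ h01, hS₀p _ _ h01.symm, mul_inv_eq_one, pairVec_comm]
    refine ⟨_, h1, fun i j hij => ?_⟩
    obtain ⟨k, hik, hjk⟩ : ∃ k, i ≠ k ∧ j ≠ k := exists_ne_ne (by omega) i j
    obtain ⟨a, rfl, rfl, rfl⟩ := exists_alternatingGroup_apply_triple (by omega) h01 h02 h12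
      hij hik hjk
    obtain ⟨y, hy⟩ := hp.surjective (SemidirectProduct.inr a)
    rw [hS₀c y a _ _ h01 hy, hS₀c y a _ _ h01.symm hy]
    calc _ = y * (S₀ (s 1) (s 0) * (S₀ (s 0) (s 1))⁻¹) * S₀ (s 0) (s 1) * y⁻¹ := by group
      _ = _ := by rw [hcen _ h1 y]; group
  have hd2 : d * d = 1 := by
    have h1 := hd _ _ h01.symm
    rw [hd _ _ h01, ← mul_assoc] at h1
    exact (mul_eq_right.mp h1.symm)
  have hdc := hcen d hdp
  -- With this scaling $l^2c=dl$, so $S_{ij}S_{jk}=d\,S_{ik}$. This imitates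
  -- $(e_ie_j)(e_je_k)=-e_ie_k$, with $d$ in the role of $-1$.
  let l : K := d * c⁻¹
  have hlp : p l = 1 := by simp [l, hdp, hcp]
  have hlc := hcen l hlp
  let S : Fin n → Fin n → K := fun i j => l * S₀ i j
  have hSp : ∀ i j, i ≠ j → p (S i j) = SemidirectProduct.inl (pairVec i j) := fun i j hij => by
    simp only [S]
    rw [map_mul, hlp, one_mul, hS₀p i j hij]
  have hSd : ∀ i j, i ≠ j → S j i = d * S i j := fun i j hij => by
    simp only [S]
    rw [hd i j hij, ← mul_assoc, hdc l, mul_assoc]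
  have hSm : ∀ i j k, i ≠ j → i ≠ k → j ≠ k → S i j * S j k = d * S i k := by
    intro i j k hij hik hjk
    simp only [S]
    calc l * S₀ i j * (l * S₀ j k) = l * (S₀ i j * l) * S₀ j k := by group
      _ = l * l * (S₀ i j * S₀ j k) := by rw [hlc]; group
      _ = d * (c⁻¹ * l) * c * S₀ i k := by rw [hc i j k hij hik hjk]; simp only [l]; group
      _ = d * (l * S₀ i k) := by rw [hlc]; group
  have hSc : ∀ (y : K) (a : alternatingGroup (Fin n)) i j, i ≠ j →
      p y = SemidirectProduct.inr a →
      S ((a : Equiv.Perm (Fin n)) i) ((a : Equiv.Perm (Fin n)) j) = y * S i j * y⁻¹ := by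
    intro y a i j hij hy
    simp only [S]
    rw [hS₀c y a i j hij hy, ← mul_assoc y, hlc y]
    group
  clear_value S
  -- Reversing all three pairs in $S_{kj}S_{ji}=d\,S_{ki}$ brings in the anticommutation sign.
  have hSa : ∀ i j k, i ≠ j → i ≠ k → j ≠ k → S j k * S i j = d * (S i j * S j k) := by
    intro i j k hij hik hjk
    have h1 := hSm k j i hjk.symm hik.symm hij.symm
    rw [hSd j k hjk, hSd i j hij, hSd i k hik] at h1
    calc S j k * S i j = (d * d) * S j k * S i j := by rw [hd2, one_mul]
      _ = d * (d * S j k) * S i j := by group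
      _ = d * S j k * (d * S i j) := by
        rw [mul_assoc d (S j k), ← mul_assoc (S j k) d, hdc (S j k), mul_assoc d (d * S j k)]
      _ = _ := by rw [h1, hSm i j k hij hik hjk]
  refine ⟨S, d, hdp, hd2, hSp, hSc, hSd, fun i j hij => ?_, hSm⟩
  have hq : p (S (s 0) (s 1) * S (s 0) (s 1)) = 1 := by
    rw [map_mul, hSp _ _ h01, ← map_mul, pairVec_mul_self, map_one]
  have hconst : ∀ i j, i ≠ j → S i j * S i j = S (s 0) (s 1) * S (s 0) (s 1) := by
    intro i j hij
    obtain ⟨k, hik, hjk⟩ : ∃ k, i ≠ k ∧ j ≠ k := exists_ne_ne (by omega) i j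
    obtain ⟨a, rfl, rfl, rfl⟩ := exists_alternatingGroup_apply_triple (by omega) h01 h02 h12
      hij hik hjk
    obtain ⟨y, hy⟩ := hp.surjective (SemidirectProduct.inr a)
    rw [hSc y a _ _ h01 hy]
    calc _ = y * (S (s 0) (s 1) * S (s 0) (s 1)) * y⁻¹ := by group
      _ = _ := by rw [hcen _ hq y]; group
  rw [hconst i j hij]
  -- The common square $q$ is central. Squaring $S_{01}S_{12}=d\,S_{02}$ and anticommuting the
  -- middle factors gives $dq^2=q$, so $q=d$.
  set q := S (s 0) (s 1) * S (s 0) (s 1) with hqdef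
  have h1 : d * S (s 0) (s 2) * (d * S (s 0) (s 2)) = q := by
    calc _ = d * (S (s 0) (s 2) * d) * S (s 0) (s 2) := by group
      _ = d * d * (S (s 0) (s 2) * S (s 0) (s 2)) := by rw [hdc]; group
      _ = q := by rw [hd2, one_mul, hconst _ _ h02]
  rw [← hSm _ _ _ h01 h02 h12] at h1
  have h2 : q * d * q = q := by
    calc q * d * q = S (s 0) (s 1) * (S (s 0) (s 1) * d) * (S (s 1) (s 2) * S (s 1) (s 2)) := by
          rw [hconst _ _ h12, hqdef]; group
      _ = S (s 0) (s 1) * (d * (S (s 0) (s 1) * S (s 1) (s 2))) * S (s 1) (s 2) := by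
          rw [hdc]; group
      _ = q := by rw [← hSa _ _ _ h01 h02 h12, ← h1]; group
  have h3 : q * d = 1 := mul_eq_right.mp h2
  exact mul_right_cancel (h3.trans hd2.symm)

end Hyperoctahedral

namespace Hyperoctahedral

open CliffordWord

/-- Even words map to every central extension of the group of evenly signed even permutations,
equivariantly under the alternating group. -/
theorem exists_evenWord_lift {K : Type*} [Group K] {n : ℕ} (hn : 7 ≤ n)
    {p : K →* EvenSignedPerm n} (hp : IsCentralExtension p) :
    ∃ f : evenWord n →* K, (∀ w, p (f w) = SemidirectProduct.inl (evenWordToVec n w)) ∧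
      ∀ (y : K) (a : alternatingGroup (Fin n)), p y = SemidirectProduct.inr a →
        ∀ w, f (altOnEvenWord n a w) = y * f w * y⁻¹ := by
  obtain ⟨S, d, hdp, hd2, hSp, hSc, hSd, hSq, hSm⟩ := exists_pairVec_lift hn hp
  have hdc : ∀ x : K, x * d = d * x := fun x =>
    Subgroup.mem_center_iff.mp (hp.ker_le_center hdp) x
  obtain ⟨m, rfl⟩ : ∃ m, n = m + 1 := ⟨n - 1, by omega⟩
  have hlt : ∀ i : Fin m, i.castSucc ≠ Fin.last m := fun i => (Fin.castSucc_lt_last i).ne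
  have hll : ∀ i j : Fin m, i ≠ j → S i.castSucc (Fin.last m) * S j.castSucc (Fin.last m) =
      S i.castSucc j.castSucc := by
    intro i j hij
    have hij' := (Fin.castSucc_injective m).ne hij
    rw [hSd _ _ (hlt j).symm, ← mul_assoc, hdc, mul_assoc, hSm _ _ _ (hlt i) hij' (hlt j).symm,
      ← mul_assoc, hd2, one_mul]
  let ψ : CliffordWord m →* K := CliffordWord.lift d (fun i => S i.castSucc (Fin.last m)) hd2
    (fun i => (hdc _).symm) (fun i => hSq _ _ (hlt i)) fun i j hij => by
      rw [hll i j hij, mul_assoc, hll j i hij.symm, hSd _ _ ((Fin.castSucc_injective m).ne hij.symm)]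
  let f : evenWord (m + 1) →* K := ψ.comp (shiftEquiv m).symm.toMonoidHom
  have hfneg : f (negWord (m + 1)) = d := by
    rw [← shiftEquiv_neg]
    simp [f, ψ]
  have hfl : ∀ i : Fin m, f (pairWord i.castSucc (Fin.last m)) = S i.castSucc (Fin.last m) := by
    intro i
    rw [← shiftEquiv_e]
    simp [f, ψ]
  -- A permutation moves a generator $e_ie_m$ to an arbitrary pair, so equivariance requires $f$ on
  -- all pairs.
  have hfS : ∀ i j, i ≠ j → f (pairWord i j) = S i j := by
    intro i j hij
    induction j using Fin.lastCases with
    | last =>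
      induction i using Fin.lastCases with
      | last => exact absurd rfl hij
      | cast i => exact hfl i
    | cast j =>
      induction i using Fin.lastCases with
      | last =>
        rw [pairWord_swap hij, map_mul, hfneg, hfl, ← hSd _ _ hij.symm]
      | cast i =>
        have hij' : i ≠ j := fun h => hij (congrArg _ h)
        rw [← pairWord_mul_pairWord _ (hlt j), map_mul, hfl, hfl, hll i j hij']
  refine ⟨f, fun w => ?_, fun y a hy w => ?_⟩
  · have h : p.comp f = SemidirectProduct.inl.comp (evenWordToVec (m + 1)) :=
      evenWord_hom_ext (by simp [hfneg, hdp, evenWordToVec_negWord]) fun i => by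
        simp [hfl, hSp _ _ (hlt i), evenWordToVec_pairWord]
    exact DFunLike.congr_fun h w
  · have h : f.comp (altOnEvenWord (m + 1) a).toMonoidHom = (MulAut.conj y).toMonoidHom.comp f := by
      refine evenWord_hom_ext ?_ fun i => ?_
      · simp [altOnEvenWord_negWord, hfneg, hdc]
      · change f (altOnEvenWord (m + 1) a (pairWord _ _)) = y * f (pairWord _ _) * y⁻¹
        rw [altOnEvenWord_pairWord, hfl, hfS _ _ ((a : Equiv.Perm _).injective.ne (hlt i)),
          hSc y a _ _ (hlt i) hy]
    exact DFunLike.congr_fun h w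

/-- The spin extension of the alternating group maps to every central extension of the group of
evenly signed even permutations. -/
theorem exists_spinAlternating_lift {K : Type*} [Group K] {n : ℕ} (hn : 8 ≤ n)
    {p : K →* EvenSignedPerm n} (hp : IsCentralExtension p) :
    ∃ f : SpinAlternating n →* K, ∀ g, p (f g) = SemidirectProduct.inr (spinToAlt n g) := by
  -- Pulling $p$ back along $A_n\subset H$ gives a central extension of $A_n$, to which the result
  -- on double covers applies.
  let D : Subgroup (K × alternatingGroup (Fin n)) := (p.comp (MonoidHom.fst K _)).eqLocus
    (SemidirectProduct.inr.comp (MonoidHom.snd K _))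
  have hD : ∀ x : D, p x.1.1 = SemidirectProduct.inr x.1.2 := fun x => x.2
  let q : D →* alternatingGroup (Fin n) := (MonoidHom.snd K _).comp D.subtype
  have hq : IsCentralExtension q := by
    refine ⟨fun g => ?_, fun x hx => Subgroup.mem_center_iff.mpr fun y => ?_⟩
    · obtain ⟨k, hk⟩ := hp.surjective (SemidirectProduct.inr g)
      exact ⟨⟨(k, g), hk⟩, rfl⟩
    · have hx : x.1.2 = 1 := hx
      refine Subtype.ext (Prod.ext ?_ ?_)
      · exact Subgroup.mem_center_iff.mp (hp.ker_le_center (by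
          rw [MonoidHom.mem_ker, hD, hx, map_one])) _
      · change y.1.2 * x.1.2 = x.1.2 * y.1.2
        rw [hx, mul_one, one_mul]
  have h01 : (⟨0, by omega⟩ : Fin n) ≠ ⟨1, by omega⟩ := by simp
  obtain ⟨φ, hφ⟩ := hq.exists_lift_of_double_cover hn (spinToAlt_surjective n) (spinNeg_ne_one h01)
    (spinToAlt_eq_one_iff h01) <| by
      intro x i j a b hij hia hib hja hjb hab hx
      have h1 : spinAltSwapSwap hia hjb ^ 2 = spinNeg h01 :=
        (spinAltSwapSwap_sq hia hij hib hja.symm hab hjb).trans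
          (SpinAlternating.ext' (by rw [coe_spinNeg, coe_spinNeg])
            (by rw [spinToAlt_spinNeg, spinToAlt_spinNeg]))
      have h2 : spinToAlt n (x * (spinAltSwapSwap hia hjb)⁻¹) = 1 := by
        rw [map_mul, map_inv, mul_inv_eq_one]
        exact Subtype.ext hx
      have h3 : spinNeg h01 ^ 2 = 1 := by
        refine SpinAlternating.ext' ?_ (by rw [map_pow, spinToAlt_spinNeg, one_pow, map_one])
        change ((spinNeg h01).1.1 : CliffordAlgebra (cliffordForm n)) ^ 2 = 1
        rw [coe_spinNeg, neg_one_sq]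
      rcases (spinToAlt_eq_one_iff h01 _).mp h2 with h | h
      · rw [mul_inv_eq_one.mp h, h1]
      -- For the standard lift $u$, the other lift is $-u=u^2u=u^3$, whose square is
      -- $(u^2)^3=(-1)^3=-1$.
      · have hx : x = spinAltSwapSwap hia hjb ^ 3 := by
          rw [pow_succ, h1]
          exact mul_inv_eq_iff_eq_mul.mp h
        rw [hx, ← pow_mul, mul_comm, pow_mul, h1, pow_succ, h3, one_mul]
  refine ⟨(MonoidHom.fst K _).comp (D.subtype.comp φ), fun g => ?_⟩
  rw [← hφ]
  exact hD (φ g)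

/-! ### The universal central extension -/

theorem spinProj_eq_one_iff {n : ℕ} {i j : Fin n} (hij : i ≠ j) (x : SpinEvenSignedPerm n) :
    spinProj n x = 1 ↔ (x.left = 1 ∨ x.left = negWord n) ∧ (x.right = 1 ∨ x.right = spinNeg hij) := by
  rw [← evenWordToVec_eq_one_iff, ← spinToAlt_eq_one_iff, SemidirectProduct.ext_iff]
  rfl

theorem spinProj_surjective (n : ℕ) : Function.Surjective (spinProj n) := by
  intro x
  obtain ⟨w, hw⟩ := evenWordToVec_surjective n x.left
  obtain ⟨g, hg⟩ := spinToAlt_surjective n x.right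
  exact ⟨⟨w, g⟩, SemidirectProduct.ext hw hg⟩

theorem spinNeg_mem_center {n : ℕ} {i j : Fin n} (hij : i ≠ j) :
    spinNeg hij ∈ Subgroup.center (SpinAlternating n) :=
  Subgroup.mem_center_iff.mpr fun x => by
    refine SpinAlternating.ext' ?_ (by rw [map_mul, map_mul, spinToAlt_spinNeg, mul_one, one_mul])
    change (x.1.1 : CliffordAlgebra (cliffordForm n)) * (spinNeg hij).1.1 =
      (spinNeg hij).1.1 * (x.1.1 : CliffordAlgebra (cliffordForm n))
    rw [coe_spinNeg, mul_neg_one, neg_one_mul]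

/-- Each $-1$ is central in its own factor. They also commute with the other factor: the spin $-1$
acts through the identity permutation, and permutations fix the Clifford word $-1$. -/
theorem isCentralExtension_spinProj {n : ℕ} {i j : Fin n} (hij : i ≠ j) :
    IsCentralExtension (spinProj n) := by
  refine ⟨spinProj_surjective n, fun x hx => Subgroup.mem_center_iff.mpr fun y => ?_⟩
  obtain ⟨h1, h2⟩ := (spinProj_eq_one_iff hij x).mp hx
  have hl : x.left ∈ Subgroup.center (evenWord n) := by
    rcases h1 with h | h
    · rw [h]; exact one_mem _
    · rw [h]; exact negWord_mem_center n
  have hr : x.right ∈ Subgroup.center (SpinAlternating n) := by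
    rcases h2 with h | h
    · rw [h]; exact one_mem _
    · rw [h]; exact spinNeg_mem_center hij
  have hσ : spinToAlt n x.right = 1 := (spinToAlt_eq_one_iff hij _).mpr h2
  refine SemidirectProduct.ext ?_ (Subgroup.mem_center_iff.mp hr _)
  change y.left * altOnEvenWord n (spinToAlt n y.right) x.left =
    x.left * altOnEvenWord n (spinToAlt n x.right) y.left
  have h3 : altOnEvenWord n (spinToAlt n y.right) x.left = x.left := by
    rcases h1 with h | h
    · rw [h, map_one]
    · rw [h, altOnEvenWord_negWord]
  rw [h3, hσ, map_one, MulAut.one_apply]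
  exact Subgroup.mem_center_iff.mp hl _

/-! ### Perfectness and universality of the semidirect product -/

/-- The products of $e_0e_2$ and $e_1e_2$ in the two orders are $e_0e_1$ and $e_1e_0=-e_0e_1$, so
$-1$ is a commutator. -/
theorem map_inl_negWord_eq_one {A : Type*} [CommGroup A] {n : ℕ} (hn : 3 ≤ n)
    (f : SpinEvenSignedPerm n →* A) : f (SemidirectProduct.inl (negWord n)) = 1 := by
  let s : Fin 3 ↪ Fin n := Fin.castLEEmb hn
  have h01 : s 0 ≠ s 1 := s.injective.ne (by decide)
  have h02 : s 0 ≠ s 2 := s.injective.ne (by decide)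
  have h12 : s 1 ≠ s 2 := s.injective.ne (by decide)
  have h1 := pairWord_mul_pairWord (s 0) h12
  have h2 := pairWord_mul_pairWord (s 1) h02
  rw [pairWord_swap h01.symm, ← h1] at h2
  have h3 := congrArg (fun w => f (SemidirectProduct.inl w)) h2
  simp only [map_mul] at h3
  rw [mul_comm] at h3
  exact mul_eq_right.mp h3.symm

theorem map_inr_spinNeg_eq_one {A : Type*} [CommGroup A] {n : ℕ} (hn : 6 ≤ n)
    (f : SpinEvenSignedPerm n →* A) {i j : Fin n} (hij : i ≠ j) :
    f (SemidirectProduct.inr (spinNeg hij)) = 1 := by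
  let s : Fin 6 ↪ Fin n := Fin.castLEEmb hn
  have hs : ∀ {a b : Fin 6}, a ≠ b → s a ≠ s b := fun h => s.injective.ne h
  have h1 := spinAltSwapSwap_mul_comm (n := n) (hs (show (0 : Fin 6) ≠ 1 by decide))
    (hs (show (2 : Fin 6) ≠ 3 by decide)) (hs (show (4 : Fin 6) ≠ 5 by decide))
    (hs (by decide)) (hs (by decide)) (hs (by decide)) (hs (by decide)) (hs (by decide))
    (hs (by decide)) (hs (by decide)) (hs (by decide)) (hs (by decide)) (hs (by decide))
    (hs (by decide)) (hs (by decide))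
  rw [show spinNeg _ = spinNeg hij from SpinAlternating.ext' (by rw [coe_spinNeg, coe_spinNeg])
    (by rw [spinToAlt_spinNeg, spinToAlt_spinNeg])] at h1
  have h3 := congrArg (fun w => f (SemidirectProduct.inr w)) h1
  generalize spinAltSwapSwap _ _ = u at h3
  simp only [map_mul] at h3
  rw [mul_comm (f (SemidirectProduct.inr u))] at h3
  exact mul_eq_right.mp h3.symm

theorem map_eq_one_of_spinProj_eq_one {A : Type*} [CommGroup A] {n : ℕ} (hn : 6 ≤ n)
    (f : SpinEvenSignedPerm n →* A) {x : SpinEvenSignedPerm n} (hx : spinProj n x = 1) :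
    f x = 1 := by
  have h01 : (⟨0, by omega⟩ : Fin n) ≠ ⟨1, by omega⟩ := by simp
  obtain ⟨h2, h3⟩ := (spinProj_eq_one_iff h01 x).mp hx
  have h5 : f (SemidirectProduct.inl x.left) = 1 := by
    rcases h2 with h | h
    · rw [h, map_one, map_one]
    · rw [h, map_inl_negWord_eq_one (by omega)]
  have h6 : f (SemidirectProduct.inr x.right) = 1 := by
    rcases h3 with h | h
    · rw [h, map_one, map_one]
    · rw [h, map_inr_spinNeg_eq_one hn]
  rw [← SemidirectProduct.inl_left_mul_inr_right x, map_mul, h5, h6, one_mul]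

/-- The semidirect product `Ã_n ⋉ F_n^{ev}` is perfect in degree at least `6`. -/
theorem isPerfect_spinEvenSignedPerm {n : ℕ} (hn : 6 ≤ n) :
    Group.IsPerfect (SpinEvenSignedPerm n) := by
  refine isPerfect_of_abelianization_of_eq_one fun x => ?_
  have hH := isPerfect_evenSignedPerm (n := n) (by omega)
  -- Since $H$ is perfect, $x$ differs from an element of the commutator subgroup by an element of
  -- the kernel, and the kernel dies in the abelianization.
  have hx : spinProj n x ∈ (commutator (SpinEvenSignedPerm n)).map (spinProj n) := by
    rw [commutator_def, Subgroup.map_commutator, ← MonoidHom.range_eq_map,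
      MonoidHom.range_eq_top.mpr (spinProj_surjective n), ← commutator_def, hH.commutator_eq_top]
    trivial
  obtain ⟨c, hc, hcx⟩ := hx
  have hcab : Abelianization.of c = 1 := Abelianization.commutator_subset_ker Abelianization.of hc
  have h1 : spinProj n (c⁻¹ * x) = 1 := by rw [map_mul, map_inv, hcx, inv_mul_cancel]
  have h2 := map_eq_one_of_spinProj_eq_one hn Abelianization.of h1
  rwa [map_mul, map_inv, hcab, inv_one, one_mul] at h2

theorem isUniversalCentralExtension_spinProj {n : ℕ} (hn : 8 ≤ n) :
    IsUniversalCentralExtension.{w} (spinProj n) := by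
  have h01 : (⟨0, by omega⟩ : Fin n) ≠ ⟨1, by omega⟩ := by simp
  refine ⟨isCentralExtension_spinProj h01, fun K _ p hp => ?_⟩
  obtain ⟨f, hf, hfc⟩ := exists_evenWord_lift (by omega) hp
  obtain ⟨g, hg⟩ := exists_spinAlternating_lift hn hp
  -- Equivariance of $f$ holds for every lift $y$ of a permutation, in particular for $y=g(x)$. This
  -- is the compatibility needed to glue $f$ and $g$.
  have hfg : ∀ x, f.comp (altOnEvenWord n (spinToAlt n x)).toMonoidHom =
      (MulAut.conj (g x)).toMonoidHom.comp f := fun x =>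
    MonoidHom.ext fun w => hfc (g x) (spinToAlt n x) (hg x) w
  have hlift : p.comp (SemidirectProduct.lift f g hfg) = spinProj n := by
    refine SemidirectProduct.hom_ext ?_ ?_
    · ext1 w
      simp [hf, spinProj]
    · ext1 x
      simp [hg, spinProj]
  exact ⟨_, hlift, fun φ hφ => (isPerfect_spinEvenSignedPerm (by omega)).hom_ext
    hp.ker_le_center (hφ.trans hlift.symm)⟩

theorem isKleinFour_ker_spinProj {n : ℕ} {i j : Fin n} (hij : i ≠ j) :
    IsKleinFour (spinProj n).ker := by
  classical
  have hmem := spinProj_eq_one_iff hij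
  let t : Bool × Bool → (spinProj n).ker := fun b =>
    ⟨⟨if b.1 then negWord n else 1, if b.2 then spinNeg hij else 1⟩, (hmem _).mpr (by
      constructor
      · by_cases h : b.1 <;> simp [h]
      · by_cases h : b.2 <;> simp [h])⟩
  have hneg : negWord n ≠ 1 := fun h => neg_ne_one n (congrArg Subtype.val h)
  have ht : Function.Bijective t := by
    constructor
    · rintro ⟨a, b⟩ ⟨c, d⟩ h
      have h1 := congrArg (fun x => x.1.left) h
      have h2 := congrArg (fun x => x.1.right) h
      have hs := spinNeg_ne_one hij
      simp only [t] at h1 h2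
      cases a <;> cases b <;> cases c <;> cases d <;> simp_all [hneg.symm, hs.symm]
    · rintro ⟨x, hx⟩
      obtain ⟨h1, h2⟩ := (hmem x).mp hx
      rcases h1 with h1 | h1 <;> rcases h2 with h2 | h2
      · exact ⟨(false, false), Subtype.ext (SemidirectProduct.ext h1.symm h2.symm)⟩
      · exact ⟨(false, true), Subtype.ext (SemidirectProduct.ext h1.symm h2.symm)⟩
      · exact ⟨(true, false), Subtype.ext (SemidirectProduct.ext h1.symm h2.symm)⟩
      · exact ⟨(true, true), Subtype.ext (SemidirectProduct.ext h1.symm h2.symm)⟩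
  have hcard : Nat.card (spinProj n).ker = 4 := by
    rw [← Nat.card_eq_of_bijective t ht]; simp
  have hnt : Nontrivial (spinProj n).ker := by
    have : Finite (spinProj n).ker := Nat.finite_of_card_ne_zero (by omega)
    rw [← Finite.one_lt_card_iff_nontrivial]; omega
  refine ⟨hcard, (Monoid.exponent_eq_prime_iff Nat.prime_two).mpr fun x hx => ?_⟩
  refine orderOf_eq_prime ?_ hx
  obtain ⟨h1, h2⟩ := (hmem x.1).mp x.2
  have hσ : spinToAlt n x.1.right = 1 := (spinToAlt_eq_one_iff hij _).mpr h2
  rw [pow_two]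
  refine Subtype.ext (SemidirectProduct.ext ?_ ?_)
  · change x.1.left * altOnEvenWord n (spinToAlt n x.1.right) x.1.left = 1
    rw [hσ, map_one, MulAut.one_apply]
    rcases h1 with h | h
    · rw [h, one_mul]
    · rw [h]; exact Subtype.ext (neg_sq n)
  · change x.1.right * x.1.right = 1
    rcases h2 with h | h
    · rw [h, one_mul]
    · rw [h]
      refine SpinAlternating.ext' ?_ (by rw [map_mul, spinToAlt_spinNeg, one_mul, map_one])
      change ((spinNeg hij).1.1 : CliffordAlgebra (cliffordForm n)) * (spinNeg hij).1.1 = 1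
      rw [coe_spinNeg, neg_mul_neg, one_mul]

end Hyperoctahedral

/-! ### The main theorem -/

theorem mainTheorem5 :
    (∀ n : ℕ, 5 ≤ n → Group.IsPerfect (Hyperoctahedral.EvenSignedPerm n)) ∧
    (∀ n : ℕ, 8 ≤ n →
      IsAddKleinFour (SchurMultiplier (Hyperoctahedral.EvenSignedPerm n)) ∧
      IsKleinFour (Hyperoctahedral.spinProj n).ker ∧
      IsUniversalCentralExtension.{w} (Hyperoctahedral.spinProj n)) := by
  refine ⟨fun n hn => Hyperoctahedral.isPerfect_evenSignedPerm hn, fun n hn => ?_⟩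
  have h01 : (⟨0, by omega⟩ : Fin n) ≠ ⟨1, by omega⟩ := by simp
  have hK := Hyperoctahedral.isKleinFour_ker_spinProj h01
  refine ⟨?_, hK, Hyperoctahedral.isUniversalCentralExtension_spinProj hn⟩
  obtain ⟨φ⟩ :=
    (Hyperoctahedral.isUniversalCentralExtension_spinProj hn).nonempty_schurMultiplier_equiv
      (Hyperoctahedral.isPerfect_spinEvenSignedPerm (by omega))
  refine ⟨?_, ?_⟩
  · rw [← hK.card_four]
    exact Nat.card_congr φ.toEquiv
  · exact Monoid.exponent_multiplicative.symm.trans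
      ((Monoid.exponent_eq_of_mulEquiv φ).trans hK.exponent_two)
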